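/- Let $\mathcal N\subset\mathbb R^d$ be a compact smooth embedded submanifold without boundary, with the induced Riemannian metric, and let $\Pi$ be its second fundamental form, $\Pi(p)(v,w)=$ the normal part of $\bar\nabla_vW$ for a tangent field $W$ extending $w$. Let $S_{jk}=S_{kj}:\mathbb R^d\to\mathbb R^d$ $(1\le j,k\le d)$ be smooth maps that extend it, in the sense that $-\sum_{j,k}S_{jk}(p)v^jw^k=\Pi(p)(v,w)$ for all $p\in\mathcal N$ and $v,w\in T_p\mathcal N$. Let $\mathbb T^1=\mathbb R/2\pi\mathbb Z$, and let $\gamma:\mathbb T^1\to\mathcal N$ be a non-constant closed geodesic, i.e. a non-constant $C^2$ solution of $\gamma_{xx}=\Pi(\gamma)(\gamma_x,\gamma_x)$. Let $$\mathcal L_\gamma\varphi=\varphi_{xx}+\sum_{r,j,k}\varphi^r\,\partial_rS_{jk}(\gamma)\,\gamma_x^j\gamma_x^k+2\sum_{j,k}S_{jk}(\gamma)\,\gamma_x^j\varphi_x^k$$ be its Jacobi operator. Assume that the sectional curvature of $\mathcal N$ is strictly negative on $\gamma$: for every $x\in\mathbb T^1$, every two-dimensional subspace of $T_{\gamma(x)}\mathcal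 N$ has negative sectional curvature. Then there is a constant $c>0$ such that $$-\langle\mathcal L_\gamma\varphi,\varphi\rangle_{L^2(\mathbb T^1)}\ \ge\ c\,\|\varphi\|_{H^1(\mathbb T^1)}^2$$ for every $\varphi\in H^1(\mathbb T^1;\mathbb R^d)$ with $\varphi(x)\in T_{\gamma(x)}\mathcal N$ for almost every $x$ and $\int_{\mathbb T^1}\langle\varphi,\gamma_x\rangle\,dx=0$. Here $\|\varphi\|_{H^1}^2=\int_{\mathbb T^1}(|\varphi|^2+|\varphi_x|^2)\,dx$, and $\langle\mathcal L_\gamma\varphi,\varphi\rangle_{L^2}$ is the duality pairing of $H^{-1}$ and $H^1$, so that $\langle\varphi_{xx},\varphi\rangle=-\int_{\mathbb T^1}|\varphi_x|^2\,dx$. -/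

import Mathlib

open scoped ContDiff

/-- `M` is a smooth embedded `m`-dimensional submanifold (without boundary) of `ℝ^d`: around each of
its points there is a smooth diffeomorphism between open sets of `ℝ^d` that carries `M` to an
`m`-dimensional linear subspace. -/
def IsSmoothSubmanifold {d : ℕ} (m : ℕ) (M : Set (EuclideanSpace ℝ (Fin d))) : Prop :=
  ∀ p ∈ M, ∃ Φ : OpenPartialHomeomorph (EuclideanSpace ℝ (Fin d)) (EuclideanSpace ℝ (Fin d)),
    p ∈ Φ.source ∧ ContDiffOn ℝ ∞ Φ Φ.source ∧ ContDiffOn ℝ ∞ Φ.symm Φ.target ∧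
      ∃ V : Submodule ℝ (EuclideanSpace ℝ (Fin d)), Module.finrank ℝ V = m ∧
        ∀ q ∈ Φ.source, (q ∈ M ↔ Φ q ∈ V)

/-- The tangent space `T_p M ⊆ ℝ^d`. For a submanifold the tangent cone is already the usual
tangent space (the velocities at `p` of curves in `M`), and the span changes nothing. -/
def tangentSpaceOf {d : ℕ} (M : Set (EuclideanSpace ℝ (Fin d))) (p : EuclideanSpace ℝ (Fin d)) :
    Submodule ℝ (EuclideanSpace ℝ (Fin d)) :=
  Submodule.span ℝ (tangentConeAt ℝ M p)

/-- The orthogonal projection `P_p` of `ℝ^d` onto `T_p M`. -/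
noncomputable def tangentProj {d : ℕ} (M : Set (EuclideanSpace ℝ (Fin d)))
    (p : EuclideanSpace ℝ (Fin d)) :
    EuclideanSpace ℝ (Fin d) →L[ℝ] EuclideanSpace ℝ (Fin d) :=
  (tangentSpaceOf M p).starProjection

/-- The Levi-Civita connection of `M` with the metric induced from `ℝ^d`: `(∇_X Y)(p)` is the
tangential part of the derivative at `p` of `Y` in the direction `X(p)`. Here and below vector
fields are tangent to `M` and only their values on `M` matter: for a tangent vector `v` at `p ∈ M`,
`fderivWithin ℝ Y M p v` is the derivative of `Y` along `M` in the direction `v`. -/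
noncomputable def covDeriv {d : ℕ} (M : Set (EuclideanSpace ℝ (Fin d)))
    (X Y : EuclideanSpace ℝ (Fin d) → EuclideanSpace ℝ (Fin d)) :
    EuclideanSpace ℝ (Fin d) → EuclideanSpace ℝ (Fin d) :=
  fun p => tangentProj M p (fderivWithin ℝ Y M p (X p))

/-- The curvature `R(X,Y)Z = ∇_Y ∇_X Z - ∇_X ∇_Y Z + ∇_{[X,Y]} Z` of `M` on tangent fields. -/
noncomputable def curvature {d : ℕ} (M : Set (EuclideanSpace ℝ (Fin d)))
    (X Y Z : EuclideanSpace ℝ (Fin d) → EuclideanSpace ℝ (Fin d)) :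
    EuclideanSpace ℝ (Fin d) → EuclideanSpace ℝ (Fin d) :=
  covDeriv M Y (covDeriv M X Z) - covDeriv M X (covDeriv M Y Z)
    + covDeriv M (VectorField.lieBracketWithin ℝ X Y M) Z

/-- The smooth tangent field `q ↦ P_q v` on `M`; it extends `v` if `v ∈ T_p M`. -/
noncomputable def tangentExtension {d : ℕ} (M : Set (EuclideanSpace ℝ (Fin d)))
    (v : EuclideanSpace ℝ (Fin d)) :
    EuclideanSpace ℝ (Fin d) → EuclideanSpace ℝ (Fin d) :=
  fun q => tangentProj M q v

/-- The second fundamental form `II_p(v,w)`, for `v, w ∈ T_p M`: the normal part of the derivative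
in the direction `v` of a tangent field extending `w` (it does not depend on the extension). -/
noncomputable def secondFundamentalForm {d : ℕ} (M : Set (EuclideanSpace ℝ (Fin d)))
    (p v w : EuclideanSpace ℝ (Fin d)) : EuclideanSpace ℝ (Fin d) :=
  fderivWithin ℝ (tangentExtension M w) M p v
    - tangentProj M p (fderivWithin ℝ (tangentExtension M w) M p v)

/-- The sectional curvature `⟨R(u,v)u, v⟩ / (|u|²|v|² - ⟨u,v⟩²)` of `M` at `p` of the plane spanned
by linearly independent `u, v ∈ T_p M`. The curvature is a tensor, so it may be evaluated on any
tangent fields that extend `u` and `v`. -/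
noncomputable def sectionalCurvature {d : ℕ} (M : Set (EuclideanSpace ℝ (Fin d)))
    (p u v : EuclideanSpace ℝ (Fin d)) : ℝ :=
  inner ℝ (curvature M (tangentExtension M u) (tangentExtension M v) (tangentExtension M u) p) v
    / (‖u‖ ^ 2 * ‖v‖ ^ 2 - inner ℝ u v ^ 2)

/-- At each point of the curve `γ`, every tangent plane of `M` has negative sectional curvature. -/
def NegativeSectionalCurvatureOn {d : ℕ} (M : Set (EuclideanSpace ℝ (Fin d)))
    (γ : ℝ → EuclideanSpace ℝ (Fin d)) : Prop :=
  ∀ x : ℝ, ∀ u ∈ tangentSpaceOf M (γ x), ∀ v ∈ tangentSpaceOf M (γ x),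
    LinearIndependent ℝ ![u, v] → sectionalCurvature M (γ x) u v < 0

/-- `γ : ℝ/2πℤ → M` is a closed geodesic, i.e. a harmonic map: `γ_xx = II_γ(γ_x, γ_x)`.
Maps on the circle are written as `2π`-periodic maps on `ℝ`. -/
structure IsClosedGeodesic {d : ℕ} (M : Set (EuclideanSpace ℝ (Fin d)))
    (γ : ℝ → EuclideanSpace ℝ (Fin d)) : Prop where
  contDiff : ContDiff ℝ 2 γ
  periodic : Function.Periodic γ (2 * Real.pi)
  mem : ∀ x, γ x ∈ M
  eqn : ∀ x, deriv (deriv γ) x = secondFundamentalForm M (γ x) (deriv γ x) (deriv γ x)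

/-- Smooth maps `S_jk = S_kj : ℝ^d → ℝ^d` with `II_p(v,w) = - ∑_{j,k} S_jk(p) v^j w^k` for
`p ∈ M` and `v, w ∈ T_p M`, i.e. an extension of the second fundamental form to `ℝ^d`. -/
structure IsExtendedSecondFundamentalForm {d : ℕ} (M : Set (EuclideanSpace ℝ (Fin d)))
    (S : Fin d → Fin d → EuclideanSpace ℝ (Fin d) → EuclideanSpace ℝ (Fin d)) : Prop where
  contDiff : ∀ j k, ContDiff ℝ ∞ (S j k)
  symm : ∀ j k p, S j k p = S k j p
  extends_form : ∀ p ∈ M, ∀ v ∈ tangentSpaceOf M p, ∀ w ∈ tangentSpaceOf M p,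
    -(∑ j, ∑ k, (v j * w k) • S j k p) = secondFundamentalForm M p v w

/-- `φ'` is the weak derivative of `φ` on the circle `ℝ/2πℤ`. -/
def IsWeakDerivCircle {d : ℕ} (φ φ' : ℝ → EuclideanSpace ℝ (Fin d)) : Prop :=
  ∀ η : ℝ → ℝ, ContDiff ℝ ∞ η → Function.Periodic η (2 * Real.pi) →
    (∫ x in (0 : ℝ)..2 * Real.pi, deriv η x • φ x)
      = -(∫ x in (0 : ℝ)..2 * Real.pi, η x • φ' x)

/-- `φ ∈ H¹(ℝ/2πℤ; γ^*(TM))`, with weak derivative `φ'`. -/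
structure IsH1TangentField {d : ℕ} (M : Set (EuclideanSpace ℝ (Fin d)))
    (γ φ φ' : ℝ → EuclideanSpace ℝ (Fin d)) : Prop where
  periodic : Function.Periodic φ (2 * Real.pi)
  memLp : MeasureTheory.MemLp φ 2 (MeasureTheory.volume.restrict (Set.Ioc 0 (2 * Real.pi)))
  memLp' : MeasureTheory.MemLp φ' 2 (MeasureTheory.volume.restrict (Set.Ioc 0 (2 * Real.pi)))
  weakDeriv : IsWeakDerivCircle φ φ'
  tangent : ∀ᵐ x : ℝ, φ x ∈ tangentSpaceOf M (γ x)

/-- The lower order part `φ^r ∂_r S_jk(γ) γ_x^j γ_x^k + 2 S_jk(γ) γ_x^j φ_x^k` of the Jacobi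
operator, with `φ'` in place of `φ_x`. -/
noncomputable def jacobiLower {d : ℕ}
    (S : Fin d → Fin d → EuclideanSpace ℝ (Fin d) → EuclideanSpace ℝ (Fin d))
    (γ φ φ' : ℝ → EuclideanSpace ℝ (Fin d)) (x : ℝ) : EuclideanSpace ℝ (Fin d) :=
  ∑ j, ∑ k, (deriv γ x j * deriv γ x k) • fderiv ℝ (S j k) (γ x) (φ x)
    + (2 : ℝ) • ∑ j, ∑ k, (deriv γ x j * φ' x k) • S j k (γ x)

/-- The Jacobi operator `L_γ φ = φ_xx + φ^r ∂_r S_jk(γ) γ_x^j γ_x^k + 2 S_jk(γ) γ_x^j φ_x^k`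
on fields `φ` of class `C²`. -/
noncomputable def jacobiOperator {d : ℕ}
    (S : Fin d → Fin d → EuclideanSpace ℝ (Fin d) → EuclideanSpace ℝ (Fin d))
    (γ φ : ℝ → EuclideanSpace ℝ (Fin d)) (x : ℝ) : EuclideanSpace ℝ (Fin d) :=
  deriv (deriv φ) x + jacobiLower S γ φ (deriv φ) x

/-- The pairing `⟨L_γ φ, ψ⟩_{L²}` for `φ, ψ ∈ H¹` with weak derivatives `φ', ψ'`. Then
`L_γ φ ∈ H^{-1}`, and the pairing is the duality of `H^{-1}` and `H¹`, with
`⟨φ_xx, ψ⟩ = -∫ ⟨φ', ψ'⟩`. -/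
noncomputable def jacobiPairing {d : ℕ}
    (S : Fin d → Fin d → EuclideanSpace ℝ (Fin d) → EuclideanSpace ℝ (Fin d))
    (γ φ φ' ψ ψ' : ℝ → EuclideanSpace ℝ (Fin d)) : ℝ :=
  -(∫ x in (0 : ℝ)..2 * Real.pi, inner ℝ (φ' x) (ψ' x))
    + ∫ x in (0 : ℝ)..2 * Real.pi, inner ℝ (jacobiLower S γ φ φ' x) (ψ x)

/-- For regular fields the pairing is the `L²` inner product of `L_γ φ` and `ψ`. -/
theorem jacobiPairing_eq_integral {d : ℕ}
    {S : Fin d → Fin d → EuclideanSpace ℝ (Fin d) → EuclideanSpace ℝ (Fin d)}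
    {γ φ ψ : ℝ → EuclideanSpace ℝ (Fin d)} (hS : ∀ j k, ContDiff ℝ ∞ (S j k))
    (hγ : ContDiff ℝ 2 γ) (hφ : ContDiff ℝ 2 φ) (hψ : ContDiff ℝ 1 ψ)
    (hφp : Function.Periodic φ (2 * Real.pi)) (hψp : Function.Periodic ψ (2 * Real.pi)) :
    jacobiPairing S γ φ (deriv φ) ψ (deriv ψ)
      = ∫ x in (0 : ℝ)..2 * Real.pi, inner ℝ (jacobiOperator S γ φ x) (ψ x) := by
  have hφ1 : ContDiff ℝ 1 (deriv φ) :=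
    ((contDiff_succ_iff_deriv (n := 1)).1 hφ).2.2
  have hφ1c : Continuous (deriv φ) := hφ1.continuous
  have hφ2 : Continuous (deriv (deriv φ)) := hφ1.continuous_deriv le_rfl
  have hψ1 : Continuous (deriv ψ) := hψ.continuous_deriv le_rfl
  have hγ1 : Continuous (deriv γ) := hγ.continuous_deriv (by norm_num)
  have hγc := hγ.continuous
  have hφc := hφ.continuous
  have hψc := hψ.continuous
  have hco : ∀ f : ℝ → EuclideanSpace ℝ (Fin d), Continuous f → ∀ i, Continuous fun x => f x i :=
    fun f hf i => (EuclideanSpace.proj (𝕜 := ℝ) i).continuous.comp hf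
  have hlow : Continuous (jacobiLower S γ φ (deriv φ)) := by
    have h1 : Continuous fun x => ∑ j, ∑ k,
        (deriv γ x j * deriv γ x k) • fderiv ℝ (S j k) (γ x) (φ x) := by
      refine continuous_finsetSum _ fun j _ => continuous_finsetSum _ fun k _ => ?_
      refine ((hco _ hγ1 j).mul (hco _ hγ1 k)).smul ?_
      exact (((hS j k).continuous_fderiv (by simp)).comp hγc).clm_apply hφc
    have h2 : Continuous fun x => ∑ j, ∑ k, (deriv γ x j * deriv φ x k) • S j k (γ x) := by
      refine continuous_finsetSum _ fun j _ => continuous_finsetSum _ fun k _ => ?_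
      exact ((hco _ hγ1 j).mul (hco _ hφ1c k)).smul ((hS j k).continuous.comp hγc)
    exact h1.add (h2.fun_const_smul (2 : ℝ))
  have hper : deriv φ (2 * Real.pi) = deriv φ 0 := by
    have h : (fun x => φ (x + 2 * Real.pi)) = φ := funext hφp
    have h2 := deriv_comp_add_const φ (2 * Real.pi) 0
    rw [h, zero_add] at h2
    exact h2.symm
  have hder : ∀ x ∈ Set.uIcc (0 : ℝ) (2 * Real.pi),
      HasDerivAt (fun x => (inner ℝ (deriv φ x) (ψ x) : ℝ))
        (inner ℝ (deriv φ x) (deriv ψ x) + inner ℝ (deriv (deriv φ) x) (ψ x)) x := fun x _ =>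
    ((hφ1.differentiable (by norm_num)) x).hasDerivAt.inner ℝ
      ((hψ.differentiable (by norm_num)) x).hasDerivAt
  have hi1 : IntervalIntegrable (fun x => (inner ℝ (deriv φ x) (deriv ψ x) : ℝ))
      MeasureTheory.volume 0 (2 * Real.pi) := (hφ1c.inner hψ1).intervalIntegrable _ _
  have hi2 : IntervalIntegrable (fun x => (inner ℝ (deriv (deriv φ) x) (ψ x) : ℝ))
      MeasureTheory.volume 0 (2 * Real.pi) := (hφ2.inner hψc).intervalIntegrable _ _
  have hi3 : IntervalIntegrable (fun x => (inner ℝ (jacobiLower S γ φ (deriv φ) x) (ψ x) : ℝ))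
      MeasureTheory.volume 0 (2 * Real.pi) := (hlow.inner hψc).intervalIntegrable _ _
  have hftc := intervalIntegral.integral_eq_sub_of_hasDerivAt hder (hi1.add hi2)
  have hψ0 : ψ (2 * Real.pi) = ψ 0 := by simpa using hψp 0
  rw [intervalIntegral.integral_add hi1 hi2, hper, hψ0, sub_self] at hftc
  simp only [jacobiPairing, jacobiOperator, inner_add_left]
  rw [intervalIntegral.integral_add hi2 hi3]
  linarith

/-!
Write `P` for the tangential projection and `II` for the second fundamental form of `M`, and let `φ`
be a tangent field along `γ`. The theorem rests on the second variation formula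

  `-⟨L φ, φ⟩ = ∫ |P φ'|² - ∫ ⟨R(γ',φ)γ', φ⟩`,

that is `IsACRepresentative.neg_jacobiPairing_eq`. It is obtained pointwise. Since `S` represents
`-II`, which is normal, differentiating `⟨S_q(P_q v, P_q v), P_q w⟩ = 0` along `M` in the direction
`w` gives the tangential part of `∂_w S(v,v)` (`inner_fderiv_extForm`). Differentiating `P φ = φ`
along `γ` shows that the normal part of `φ'` is `II(γ',φ)`. With `v = γ'` and `w = φ`, the terms
quadratic in `S` cancel, and what is left of the lower order terms is `⟨II(γ',γ'), II(φ,φ)⟩`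
(`inner_jacobi_lower_terms`). As `|φ'|² = |P φ'|² + |II(γ',φ)|²`, the Gauss equation
(`IsProjExtension.inner_curvature`) turns the remainder into curvature.

Both terms of the formula are nonnegative and control `φ`. The velocity `γ'` is parallel and of
constant length. The part of `φ` orthogonal to `γ'` is controlled by the curvature term, uniformly
in `x` by compactness (`exists_negCurvatureForm_ge`). The part along `γ'` has the coefficient
`⟨φ, γ'⟩`, of mean zero and with derivative `⟨P φ', γ'⟩`, so the Poincaré inequality bounds it by
`∫ |P φ'|²` (`IsACRepresentative.integral_inner_sq_le`). Finally `|φ'|² - |P φ'|² = |II(γ',φ)|²` is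
at most a constant times `|φ|²`.

Two technical points. Derivatives within `M` are not unique as linear maps on `ℝ^d`, but they are
on tangent vectors; they are computed with a smooth extension of `P` to an open set, which is
`e (e + e⋆ - 1)⁻¹` for a smooth field `e` of idempotents with range the tangent space
(`IsSmoothSubmanifold.exists_contDiffOn_tangentProj`). And an `H¹` field is replaced by an
absolutely continuous representative, so that the product rule holds almost everywhere
(`exists_absolutelyContinuous_of_isWeakDerivCircle`).
-/

/-! ### The tangential projection extends smoothly to a neighbourhood -/

section Idempotent

variable {E : Type*} [NormedAddCommGroup E] [InnerProductSpace ℝ E] [FiniteDimensional ℝ E]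

/-- If `e` is idempotent, then `e + e⋆ - 1` is invertible, because it is injective: from
`e x + e⋆ x = x` one gets `e e⋆ x = 0`, hence `e⋆ x = 0` and `e x = x`, and likewise `e x = 0`. -/
theorem isUnit_add_star_sub_one {e : E →L[ℝ] E} (he : e * e = e) :
    IsUnit (e + star e - 1) := by
  have hs : star e * star e = star e := by rw [← star_mul, he]
  have hinj : Function.Injective (e + star e - 1 : E →L[ℝ] E) := by
    refine (injective_iff_map_eq_zero _).2 fun x hx => ?_
    have hx' : e x + (star e) x - x = 0 := hx
    have hee : ∀ y, e (e y) = e y := fun y => DFunLike.congr_fun he y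
    have hss : ∀ y, (star e) ((star e) y) = (star e) y := fun y => DFunLike.congr_fun hs y
    have hadj : ∀ y z, inner ℝ ((star e) y) z = inner ℝ y (e z) := fun y z => by
      rw [ContinuousLinearMap.star_eq_adjoint, ContinuousLinearMap.adjoint_inner_left]
    have h1 : e ((star e) x) = 0 := by
      have := congrArg e hx'
      simpa [hee] using this
    have h2 : (star e) (e x) = 0 := by
      have := congrArg (fun y => (star e) y) hx'
      simpa [hss] using this
    have h3 : (star e) x = 0 := by
      rw [← inner_self_eq_zero (𝕜 := ℝ), hadj, h1, inner_zero_right]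
    have h4 : e x = 0 := by
      rw [← inner_self_eq_zero (𝕜 := ℝ), ← hadj, h2, inner_zero_left]
    simpa [h3, h4] using hx'
  rw [ContinuousLinearMap.isUnit_iff_bijective]
  exact ⟨hinj, LinearMap.surjective_of_injective
    (f := ((e + star e - 1 : E →L[ℝ] E) : E →ₗ[ℝ] E)) hinj⟩

/-- The orthogonal projection onto the range of an idempotent `e` is `e (e + e⋆ - 1)⁻¹`. -/
theorem starProjection_eq_mul_inverse {e : E →L[ℝ] E} {K : Submodule ℝ E}
    (hK : ∀ x, e x ∈ K) (heK : ∀ x ∈ K, e x = x) :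
    K.starProjection = e * Ring.inverse (e + star e - 1) := by
  have he : e * e = e := by ext1 x; exact heK _ (hK x)
  have h1 : K.starProjection * e = e := by
    ext1 x; exact Submodule.starProjection_eq_self_iff.2 (hK x)
  have h2 : e * K.starProjection = K.starProjection := by
    ext1 x; exact heK _ (Submodule.starProjection_apply_mem K x)
  have hP : star K.starProjection = K.starProjection := isSelfAdjoint_starProjection K
  have h3 : K.starProjection * star e = K.starProjection := by
    have := congrArg star h2
    rwa [star_mul, hP] at this
  have h4 : K.starProjection * (e + star e - 1) = e := by
    rw [mul_sub, mul_add, h1, h3]; simp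
  rw [Ring.eq_mul_inverse_iff_mul_eq _ _ _ (isUnit_add_star_sub_one he), h4]

end Idempotent

variable {d m : ℕ} {M : Set (EuclideanSpace ℝ (Fin d))}

/-- In a chart `Φ` that flattens `M` to `V`, the map `(DΦ)⁻¹ R DΦ`, where `R` is the orthogonal
projection onto `V`, is idempotent with range the tangent space. -/
theorem chart_idempotent
    {Φ : OpenPartialHomeomorph (EuclideanSpace ℝ (Fin d)) (EuclideanSpace ℝ (Fin d))}
    (h1 : ContDiffOn ℝ ∞ Φ Φ.source) (h2 : ContDiffOn ℝ ∞ Φ.symm Φ.target)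
    {V : Submodule ℝ (EuclideanSpace ℝ (Fin d))} (hV : ∀ q ∈ Φ.source, (q ∈ M ↔ Φ q ∈ V))
    {q : EuclideanSpace ℝ (Fin d)} (hq : q ∈ Φ.source) (hqM : q ∈ M) :
    (∀ x, fderiv ℝ Φ.symm (Φ q) (V.starProjection (fderiv ℝ Φ q x)) ∈ tangentSpaceOf M q) ∧
    ∀ x ∈ tangentSpaceOf M q,
      fderiv ℝ Φ.symm (Φ q) (V.starProjection (fderiv ℝ Φ q x)) = x := by
  have hs : Φ.source ∈ nhds q := Φ.open_source.mem_nhds hq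
  have hqt : Φ q ∈ Φ.target := Φ.map_source hq
  have ht : Φ.target ∈ nhds (Φ q) := Φ.open_target.mem_nhds hqt
  have hA : HasFDerivAt Φ (fderiv ℝ Φ q) q :=
    ((h1.contDiffAt hs).differentiableAt (by simp)).hasFDerivAt
  have hC : HasFDerivAt Φ.symm (fderiv ℝ Φ.symm (Φ q)) (Φ q) :=
    ((h2.contDiffAt ht).differentiableAt (by simp)).hasFDerivAt
  have hCA : ∀ x, fderiv ℝ Φ.symm (Φ q) (fderiv ℝ Φ q x) = x := by
    have h3 : HasFDerivAt (Φ.symm ∘ Φ) ((fderiv ℝ Φ.symm (Φ q)).comp (fderiv ℝ Φ q)) q :=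
      hC.comp q hA
    have h4 : HasFDerivAt (Φ.symm ∘ Φ) (ContinuousLinearMap.id ℝ _) q :=
      (hasFDerivAt_id q).congr_of_eventuallyEq
        (Filter.mem_of_superset hs fun y hy => Φ.left_inv hy)
    exact fun x => DFunLike.congr_fun (h3.unique h4) x
  have hΦV : Φ q ∈ V := (hV q hq).1 hqM
  constructor
  · intro x
    refine Submodule.subset_span ?_
    have hv : V.starProjection (fderiv ℝ Φ q x)
        ∈ tangentConeAt ℝ ((V : Set _) ∩ Φ.target) (Φ q) := by
      rw [tangentConeAt_inter_nhds ht]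
      have := mem_tangentConeAt_of_segment_subset (s := (V : Set (EuclideanSpace ℝ (Fin d))))
        (x := Φ q) (y := Φ q + V.starProjection (fderiv ℝ Φ q x))
        (V.convex.segment_subset hΦV (V.add_mem hΦV (Submodule.starProjection_apply_mem V _)))
      simpa using this
    have := hC.hasFDerivWithinAt.mapsTo_tangent_cone hv
    rw [Φ.left_inv hq] at this
    refine tangentConeAt_mono ?_ this
    rintro _ ⟨y, ⟨hyV, hyt⟩, rfl⟩
    refine (hV _ (Φ.map_target hyt)).2 ?_
    rwa [Φ.right_inv hyt]
  · -- `DΦ` maps the tangent cone of `M` into that of `V`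
    have hsub : tangentSpaceOf M q ≤ V.comap (fderiv ℝ Φ q : _ →ₗ[ℝ] _) := by
      refine Submodule.span_le.2 fun x hx => ?_
      rw [← tangentConeAt_inter_nhds hs] at hx
      have := hA.hasFDerivWithinAt.mapsTo_tangent_cone hx
      have h5 : tangentConeAt ℝ (Φ '' (M ∩ Φ.source)) (Φ q) ⊆ V := by
        have h6 : Φ '' (M ∩ Φ.source) ⊆ V := by
          rintro _ ⟨y, ⟨hyM, hys⟩, rfl⟩
          exact (hV y hys).1 hyM
        intro z hz
        -- the coordinates normal to `V` are a linear map that vanishes on `V`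
        have h7 : HasFDerivWithinAt (fun y => y - V.starProjection y)
            (ContinuousLinearMap.id ℝ _ - V.starProjection) V (Φ q) :=
          (ContinuousLinearMap.id ℝ _ - V.starProjection).hasFDerivWithinAt
        have h8 : HasFDerivWithinAt (fun y => y - V.starProjection y)
            (0 : EuclideanSpace ℝ (Fin d) →L[ℝ] EuclideanSpace ℝ (Fin d)) V (Φ q) :=
          (hasFDerivWithinAt_const 0 _ _).congr
            (fun y hy => by simp [Submodule.starProjection_eq_self_iff.2 hy])
            (by simp [Submodule.starProjection_eq_self_iff.2 hΦV])
        have h9 := h7.unique_on h8 (tangentConeAt_mono h6 hz)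
        have h10 : z - V.starProjection z = 0 := h9
        exact Submodule.starProjection_eq_self_iff.1 (sub_eq_zero.1 h10).symm
      exact h5 this
    intro x hx
    have hxV : fderiv ℝ Φ q x ∈ V := hsub hx
    rw [Submodule.starProjection_eq_self_iff.2 hxV, hCA]

/-- Near each of its points, the tangential projection of a submanifold is the restriction of a
smooth map on an open set of `ℝ^d`. -/
theorem IsSmoothSubmanifold.exists_contDiffOn_tangentProj (hM : IsSmoothSubmanifold m M)
    {p : EuclideanSpace ℝ (Fin d)} (hp : p ∈ M) :
    ∃ (U : Set (EuclideanSpace ℝ (Fin d)))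
      (Q : EuclideanSpace ℝ (Fin d) → EuclideanSpace ℝ (Fin d) →L[ℝ] EuclideanSpace ℝ (Fin d)),
      IsOpen U ∧ p ∈ U ∧ ContDiffOn ℝ ∞ Q U ∧ ∀ q ∈ M ∩ U, Q q = tangentProj M q := by
  obtain ⟨Φ, hpΦ, h1, h2, V, -, hV⟩ := hM p hp
  let e : EuclideanSpace ℝ (Fin d) → EuclideanSpace ℝ (Fin d) →L[ℝ] EuclideanSpace ℝ (Fin d) :=
    fun q => (fderiv ℝ Φ.symm (Φ q)).comp (V.starProjection.comp (fderiv ℝ Φ q))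
  have he : ContDiffOn ℝ ∞ e Φ.source := by
    have h3 : ContDiffOn ℝ ∞ (fderiv ℝ Φ) Φ.source := h1.fderiv_of_isOpen Φ.open_source (by simp)
    have h4 : ContDiffOn ℝ ∞ (fderiv ℝ Φ.symm) Φ.target :=
      h2.fderiv_of_isOpen Φ.open_target (by simp)
    exact (h4.comp h1 fun y hy => Φ.map_source hy).clm_comp (contDiffOn_const.clm_comp h3)
  have hee : ∀ q ∈ Φ.source, e q * e q = e q := by
    have hAC : ∀ q ∈ Φ.source, ∀ x, fderiv ℝ Φ q (fderiv ℝ Φ.symm (Φ q) x) = x := by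
      intro q hq
      have hqt : Φ q ∈ Φ.target := Φ.map_source hq
      have ht : Φ.target ∈ nhds (Φ q) := Φ.open_target.mem_nhds hqt
      have hA : HasFDerivAt Φ (fderiv ℝ Φ q) (Φ.symm (Φ q)) := by
        rw [Φ.left_inv hq]
        exact ((h1.contDiffAt (Φ.open_source.mem_nhds hq)).differentiableAt (by simp)).hasFDerivAt
      have hC : HasFDerivAt Φ.symm (fderiv ℝ Φ.symm (Φ q)) (Φ q) :=
        ((h2.contDiffAt ht).differentiableAt (by simp)).hasFDerivAt
      have h4 : HasFDerivAt (Φ ∘ Φ.symm) (ContinuousLinearMap.id ℝ _) (Φ q) :=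
        (hasFDerivAt_id _).congr_of_eventuallyEq
          (Filter.mem_of_superset ht fun y hy => Φ.right_inv hy)
      exact fun x => DFunLike.congr_fun ((hA.comp _ hC).unique h4) x
    intro q hq
    ext1 x
    change e q (e q x) = e q x
    simp only [e, ContinuousLinearMap.comp_apply]
    rw [hAC q hq, Submodule.starProjection_eq_self_iff.2 (Submodule.starProjection_apply_mem V _)]
  refine ⟨Φ.source, fun q => e q * Ring.inverse (e q + star (e q) - 1), Φ.open_source, hpΦ,
    ?_, ?_⟩
  · have hstar : ContDiffOn ℝ ∞ (fun q => star (e q)) Φ.source :=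
      ContDiff.comp_contDiffOn
        (starL' ℝ : (EuclideanSpace ℝ (Fin d) →L[ℝ] EuclideanSpace ℝ (Fin d)) ≃L[ℝ] _).contDiff he
    refine he.clm_comp fun q hq => ?_
    obtain ⟨u, hu⟩ := isUnit_add_star_sub_one (hee q hq)
    have hinv := contDiffAt_ringInverse ℝ (n := ∞) u
    rw [hu] at hinv
    exact hinv.comp_contDiffWithinAt q (((he.add hstar).sub contDiffOn_const) q hq)
  · rintro q ⟨hqM, hq⟩
    obtain ⟨h5, h6⟩ := chart_idempotent h1 h2 hV hq hqM
    exact (starProjection_eq_mul_inverse h5 h6).symm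

/-! ### Derivatives along a submanifold -/

theorem tangentProj_eq_self {p v : EuclideanSpace ℝ (Fin d)} (hv : v ∈ tangentSpaceOf M p) :
    tangentProj M p v = v :=
  Submodule.starProjection_eq_self_iff.2 hv

theorem tangentProj_mem (p v : EuclideanSpace ℝ (Fin d)) :
    tangentProj M p v ∈ tangentSpaceOf M p :=
  Submodule.starProjection_apply_mem _ v

theorem inner_tangentProj_left (p v w : EuclideanSpace ℝ (Fin d)) :
    inner ℝ (tangentProj M p v) w = inner ℝ v (tangentProj M p w) :=
  Submodule.inner_starProjection_left_eq_right _ v w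

/-- A derivative within `M` is not unique as a linear map on `ℝ^d`, but its values on tangent
vectors are determined. -/
theorem HasFDerivWithinAt.fderivWithin_apply_tangent {F : Type*} [NormedAddCommGroup F]
    [NormedSpace ℝ F] {f : EuclideanSpace ℝ (Fin d) → F} {f' : EuclideanSpace ℝ (Fin d) →L[ℝ] F}
    {p v : EuclideanSpace ℝ (Fin d)} (h : HasFDerivWithinAt f f' M p)
    (hv : v ∈ tangentSpaceOf M p) : fderivWithin ℝ f M p v = f' v :=
  LinearMap.eqOn_span (f := (fderivWithin ℝ f M p : _ →ₗ[ℝ] F)) (g := (f' : _ →ₗ[ℝ] F))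
    (h.differentiableWithinAt.hasFDerivWithinAt.unique_on h) hv

/-- If two maps that are differentiable at `p` agree on `M` near `p`, then their derivatives
agree on the tangent vectors at `p`. -/
theorem HasFDerivAt.eq_of_eqOn_tangent {F : Type*} [NormedAddCommGroup F]
    [NormedSpace ℝ F] {f g : EuclideanSpace ℝ (Fin d) → F}
    {f' g' : EuclideanSpace ℝ (Fin d) →L[ℝ] F}
    {p v : EuclideanSpace ℝ (Fin d)} {U : Set (EuclideanSpace ℝ (Fin d))}
    (hf : HasFDerivAt f f' p) (hg : HasFDerivAt g g' p) (hU : IsOpen U) (hpU : p ∈ U) (hp : p ∈ M)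
    (h : ∀ q ∈ M ∩ U, f q = g q) (hv : v ∈ tangentSpaceOf M p) : f' v = g' v := by
  have h1 : HasFDerivWithinAt f g' M p := hg.hasFDerivWithinAt.congr_of_eventuallyEq
    (Filter.mem_of_superset (inter_mem_nhdsWithin M (hU.mem_nhds hpU)) h) (h p ⟨hp, hpU⟩)
  rw [← hf.hasFDerivWithinAt.fderivWithin_apply_tangent hv, h1.fderivWithin_apply_tangent hv]

theorem deriv_mem_tangentSpaceOf {γ : ℝ → EuclideanSpace ℝ (Fin d)} (hmem : ∀ x, γ x ∈ M) {x : ℝ}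
    (hγ : DifferentiableAt ℝ γ x) : deriv γ x ∈ tangentSpaceOf M (γ x) := by
  refine Submodule.subset_span ?_
  have h1 : (1 : ℝ) ∈ tangentConeAt ℝ (Set.univ : Set ℝ) x := by simp
  have h2 := hγ.hasDerivAt.hasFDerivAt.hasFDerivWithinAt.mapsTo_tangent_cone h1
  rw [Set.image_univ] at h2
  simpa using tangentConeAt_mono (Set.range_subset_iff.2 hmem) h2

/-- `Q` is a smooth map on the open set `U` of `ℝ^d` that equals the tangential projection of `M`
at the points of `M` in `U`. -/
structure IsProjExtension (M : Set (EuclideanSpace ℝ (Fin d))) (U : Set (EuclideanSpace ℝ (Fin d)))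
    (Q : EuclideanSpace ℝ (Fin d) → EuclideanSpace ℝ (Fin d) →L[ℝ] EuclideanSpace ℝ (Fin d)) :
    Prop where
  isOpen : IsOpen U
  contDiffOn : ContDiffOn ℝ ∞ Q U
  eq_tangentProj : ∀ q ∈ M ∩ U, Q q = tangentProj M q

namespace IsProjExtension

variable {U : Set (EuclideanSpace ℝ (Fin d))}
  {Q : EuclideanSpace ℝ (Fin d) → EuclideanSpace ℝ (Fin d) →L[ℝ] EuclideanSpace ℝ (Fin d)}
  {p u v w : EuclideanSpace ℝ (Fin d)}

theorem hasFDerivAt (h : IsProjExtension M U Q) (hpU : p ∈ U) : HasFDerivAt Q (fderiv ℝ Q p) p :=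
  ((h.contDiffOn.contDiffAt (h.isOpen.mem_nhds hpU)).differentiableAt (by simp)).hasFDerivAt

theorem hasFDerivAt_fderiv (h : IsProjExtension M U Q) (hpU : p ∈ U) :
    HasFDerivAt (fderiv ℝ Q) (fderiv ℝ (fderiv ℝ Q) p) p :=
  (((h.contDiffOn.fderiv_of_isOpen h.isOpen (m := 1) (by norm_cast)).contDiffAt
    (h.isOpen.mem_nhds hpU)).differentiableAt (by simp)).hasFDerivAt

theorem eventuallyEq (h : IsProjExtension M U Q) (hpU : p ∈ U) :
    tangentProj M =ᶠ[nhdsWithin p M] Q :=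
  Filter.mem_of_superset (inter_mem_nhdsWithin M (h.isOpen.mem_nhds hpU))
    fun q hq => (h.eq_tangentProj q hq).symm

theorem apply_eq_self (h : IsProjExtension M U Q) (hp : p ∈ M) (hpU : p ∈ U)
    (hv : v ∈ tangentSpaceOf M p) : Q p v = v := by
  rw [h.eq_tangentProj p ⟨hp, hpU⟩, tangentProj_eq_self hv]

theorem apply_mem (h : IsProjExtension M U Q) (hp : p ∈ M) (hpU : p ∈ U)
    (v : EuclideanSpace ℝ (Fin d)) : Q p v ∈ tangentSpaceOf M p := by
  rw [h.eq_tangentProj p ⟨hp, hpU⟩]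
  exact tangentProj_mem p v

theorem inner_left (h : IsProjExtension M U Q) (hp : p ∈ M) (hpU : p ∈ U)
    (v w : EuclideanSpace ℝ (Fin d)) : inner ℝ (Q p v) w = inner ℝ v (Q p w) := by
  rw [h.eq_tangentProj p ⟨hp, hpU⟩, inner_tangentProj_left]

theorem hasFDerivAt_apply (h : IsProjExtension M U Q) (hpU : p ∈ U)
    (w : EuclideanSpace ℝ (Fin d)) :
    HasFDerivAt (fun q => Q q w) ((fderiv ℝ Q p).flip w) p := by
  simpa using (h.hasFDerivAt hpU).clm_apply (hasFDerivAt_const w p)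

/-- The derivative of `Q Q = Q`. -/
theorem fderiv_idempotent (h : IsProjExtension M U Q) (hp : p ∈ M) (hpU : p ∈ U)
    (hv : v ∈ tangentSpaceOf M p) (w : EuclideanSpace ℝ (Fin d)) :
    Q p (fderiv ℝ Q p v w) + fderiv ℝ Q p v (Q p w) = fderiv ℝ Q p v w := by
  have h1 := (h.hasFDerivAt hpU).clm_apply (h.hasFDerivAt_apply hpU w)
  have := h1.eq_of_eqOn_tangent (h.hasFDerivAt_apply hpU w) h.isOpen hpU hp
    (fun q hq => h.apply_eq_self hq.1 hq.2 (h.apply_mem hq.1 hq.2 w)) hv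
  simpa using this

theorem inner_fderiv_left (h : IsProjExtension M U Q) (hp : p ∈ M) (hpU : p ∈ U)
    (hv : v ∈ tangentSpaceOf M p) (x y : EuclideanSpace ℝ (Fin d)) :
    inner ℝ (fderiv ℝ Q p v x) y = inner ℝ x (fderiv ℝ Q p v y) := by
  have h1 := (h.hasFDerivAt_apply hpU x).inner ℝ (hasFDerivAt_const y p)
  have h2 := (hasFDerivAt_const x p).inner ℝ (h.hasFDerivAt_apply hpU y)
  have := h1.eq_of_eqOn_tangent h2 h.isOpen hpU hp
    (fun q hq => h.inner_left hq.1 hq.2 x y) hv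
  simpa [fderivInnerCLM_apply] using this

theorem apply_fderiv_eq_zero (h : IsProjExtension M U Q) (hp : p ∈ M) (hpU : p ∈ U)
    (hv : v ∈ tangentSpaceOf M p) (hw : w ∈ tangentSpaceOf M p) :
    Q p (fderiv ℝ Q p v w) = 0 := by
  have := h.fderiv_idempotent hp hpU hv w
  rwa [h.apply_eq_self hp hpU hw, add_eq_right] at this

theorem hasFDerivWithinAt_tangentExtension (h : IsProjExtension M U Q) (hp : p ∈ M) (hpU : p ∈ U)
    (w : EuclideanSpace ℝ (Fin d)) :
    HasFDerivWithinAt (tangentExtension M w) ((fderiv ℝ Q p).flip w) M p :=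
  (h.hasFDerivAt_apply hpU w).hasFDerivWithinAt.congr_of_eventuallyEq
    ((h.eventuallyEq hpU).mono fun q hq => by simp [tangentExtension, hq])
    (by simp [tangentExtension, h.eq_tangentProj p ⟨hp, hpU⟩])

theorem secondFundamentalForm_eq (h : IsProjExtension M U Q) (hp : p ∈ M) (hpU : p ∈ U)
    (hv : v ∈ tangentSpaceOf M p) (hw : w ∈ tangentSpaceOf M p) :
    secondFundamentalForm M p v w = fderiv ℝ Q p v w := by
  rw [secondFundamentalForm,
    (h.hasFDerivWithinAt_tangentExtension hp hpU w).fderivWithin_apply_tangent hv,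
    ← h.eq_tangentProj p ⟨hp, hpU⟩, ContinuousLinearMap.flip_apply,
    h.apply_fderiv_eq_zero hp hpU hv hw, sub_zero]

theorem covDeriv_tangentExtension (h : IsProjExtension M U Q) (hp : p ∈ M) (hpU : p ∈ U)
    (u w : EuclideanSpace ℝ (Fin d)) :
    covDeriv M (tangentExtension M u) (tangentExtension M w) p
      = Q p (fderiv ℝ Q p (Q p u) w) := by
  rw [covDeriv, tangentExtension, ← h.eq_tangentProj p ⟨hp, hpU⟩,
    (h.hasFDerivWithinAt_tangentExtension hp hpU w).fderivWithin_apply_tangent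
      (h.apply_mem hp hpU u), ContinuousLinearMap.flip_apply]

theorem covDeriv_covDeriv_tangentExtension (h : IsProjExtension M U Q) (hp : p ∈ M) (hpU : p ∈ U)
    (hu : u ∈ tangentSpaceOf M p) (hv : v ∈ tangentSpaceOf M p) (w : EuclideanSpace ℝ (Fin d)) :
    covDeriv M (tangentExtension M v) (covDeriv M (tangentExtension M u) (tangentExtension M w)) p
      = Q p (fderiv ℝ Q p v (fderiv ℝ Q p u w)) + Q p (fderiv ℝ (fderiv ℝ Q) p v u w
          + fderiv ℝ Q p (fderiv ℝ Q p v u) w) := by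
  have h1 := (h.hasFDerivAt_fderiv hpU).clm_apply (h.hasFDerivAt_apply hpU u)
  have h2 := h1.clm_apply (hasFDerivAt_const w p)
  have h3 := (h.hasFDerivAt hpU).clm_apply h2
  have h4 := h3.hasFDerivWithinAt (s := M) |>.congr_of_eventuallyEq
    (f₁ := covDeriv M (tangentExtension M u) (tangentExtension M w))
    (Filter.mem_of_superset (inter_mem_nhdsWithin M (h.isOpen.mem_nhds hpU))
      fun q hq => h.covDeriv_tangentExtension hq.1 hq.2 u w)
    (h.covDeriv_tangentExtension hp hpU u w)
  have h5 : tangentExtension M v p = v := tangentProj_eq_self hv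
  rw [covDeriv, h5, h4.fderivWithin_apply_tangent hv, ← h.eq_tangentProj p ⟨hp, hpU⟩]
  have h6 : ∀ x, Q p (Q p x) = Q p x := fun x =>
    h.apply_eq_self hp hpU (h.apply_mem hp hpU x)
  simp [h6, h.apply_eq_self hp hpU hu]
  abel

/-- The Gauss equation: the curvature `⟨R(u,v)u, v⟩` is `⟨II(u,u), II(v,v)⟩ - |II(u,v)|²`. -/
theorem inner_curvature (h : IsProjExtension M U Q) (hp : p ∈ M) (hpU : p ∈ U)
    (hu : u ∈ tangentSpaceOf M p) (hv : v ∈ tangentSpaceOf M p)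
    (hsymm : secondFundamentalForm M p u v = secondFundamentalForm M p v u) :
    inner ℝ (curvature M (tangentExtension M u) (tangentExtension M v) (tangentExtension M u) p) v
      = inner ℝ (secondFundamentalForm M p u u) (secondFundamentalForm M p v v)
        - ‖secondFundamentalForm M p u v‖ ^ 2 := by
  rw [h.secondFundamentalForm_eq hp hpU hu hv, h.secondFundamentalForm_eq hp hpU hv hu] at hsymm
  rw [h.secondFundamentalForm_eq hp hpU hu hv, h.secondFundamentalForm_eq hp hpU hv hv,
    h.secondFundamentalForm_eq hp hpU hu hu]
  have hu' : tangentExtension M u p = u := tangentProj_eq_self hu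
  have hv' : tangentExtension M v p = v := tangentProj_eq_self hv
  have hbr : VectorField.lieBracketWithin ℝ (tangentExtension M u) (tangentExtension M v) M p
      = 0 := by
    rw [VectorField.lieBracketWithin, hu', hv',
      (h.hasFDerivWithinAt_tangentExtension hp hpU v).fderivWithin_apply_tangent hu,
      (h.hasFDerivWithinAt_tangentExtension hp hpU u).fderivWithin_apply_tangent hv]
    simp [hsymm]
  have hD2 : fderiv ℝ (fderiv ℝ Q) p v u = fderiv ℝ (fderiv ℝ Q) p u v :=
    ((h.contDiffOn.contDiffAt (h.isOpen.mem_nhds hpU)).isSymmSndFDerivAt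
      (by simpa using ENat.LEInfty.out)) v u
  have hcov : covDeriv M
      (VectorField.lieBracketWithin ℝ (tangentExtension M u) (tangentExtension M v) M)
      (tangentExtension M u) p = 0 := by
    rw [covDeriv, hbr]; simp
  simp only [curvature, Pi.add_apply, Pi.sub_apply]
  rw [hcov, add_zero, h.covDeriv_covDeriv_tangentExtension hp hpU hu hv,
    h.covDeriv_covDeriv_tangentExtension hp hpU hv hu, hD2, ← hsymm, add_sub_add_right_eq_sub,
    inner_sub_left, h.inner_left hp hpU, h.inner_left hp hpU, h.apply_eq_self hp hpU hv,
    h.inner_fderiv_left hp hpU hv (fderiv ℝ Q p u u) v,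
    h.inner_fderiv_left hp hpU hu (fderiv ℝ Q p u v) v, real_inner_self_eq_norm_sq]

end IsProjExtension

theorem IsSmoothSubmanifold.exists_isProjExtension (hM : IsSmoothSubmanifold m M)
    {p : EuclideanSpace ℝ (Fin d)} (hp : p ∈ M) : ∃ U Q, p ∈ U ∧ IsProjExtension M U Q := by
  obtain ⟨U, Q, h1, h2, h3, h4⟩ := hM.exists_contDiffOn_tangentProj hp
  exact ⟨U, Q, h2, h1, h3, h4⟩

variable {S : Fin d → Fin d → EuclideanSpace ℝ (Fin d) → EuclideanSpace ℝ (Fin d)}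
  {γ : ℝ → EuclideanSpace ℝ (Fin d)}

/-! ### The extended second fundamental form -/

/-- The bilinear form `∑ S_jk(p) v^j w^k`. On tangent vectors of `M` it is *minus* the second
fundamental form. -/
noncomputable def extForm (S : Fin d → Fin d → EuclideanSpace ℝ (Fin d) → EuclideanSpace ℝ (Fin d))
    (p v w : EuclideanSpace ℝ (Fin d)) : EuclideanSpace ℝ (Fin d) :=
  ∑ j, ∑ k, (v j * w k) • S j k p

theorem extForm_add_left (p v v' w : EuclideanSpace ℝ (Fin d)) :
    extForm S p (v + v') w = extForm S p v w + extForm S p v' w := by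
  simp [extForm, add_mul, add_smul, Finset.sum_add_distrib]

theorem extForm_smul_left (p v w : EuclideanSpace ℝ (Fin d)) (c : ℝ) :
    extForm S p (c • v) w = c • extForm S p v w := by
  simp [extForm, Finset.smul_sum, smul_smul, mul_assoc]

theorem extForm_add_right (p v w w' : EuclideanSpace ℝ (Fin d)) :
    extForm S p v (w + w') = extForm S p v w + extForm S p v w' := by
  simp [extForm, mul_add, add_smul, Finset.sum_add_distrib]

theorem extForm_smul_right (p v w : EuclideanSpace ℝ (Fin d)) (c : ℝ) :
    extForm S p v (c • w) = c • extForm S p v w := by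
  simp [extForm, Finset.smul_sum, smul_smul, mul_left_comm]

theorem extForm_symm (hS : IsExtendedSecondFundamentalForm M S)
    (p v w : EuclideanSpace ℝ (Fin d)) : extForm S p v w = extForm S p w v := by
  rw [extForm, extForm, Finset.sum_comm]
  exact Finset.sum_congr rfl fun j _ => Finset.sum_congr rfl fun k _ => by
    rw [hS.symm k j, mul_comm]

theorem continuous_extForm (hS : IsExtendedSecondFundamentalForm M S) {X : Type*}
    [TopologicalSpace X] {p v w : X → EuclideanSpace ℝ (Fin d)} (hp : Continuous p)
    (hv : Continuous v) (hw : Continuous w) :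
    Continuous fun x => extForm S (p x) (v x) (w x) := by
  unfold extForm
  refine continuous_finsetSum _ fun j _ => continuous_finsetSum _ fun k _ => ?_
  have h1 := (hS.contDiff j k).continuous.comp hp
  have h2 := (EuclideanSpace.proj (𝕜 := ℝ) j).continuous.comp hv
  have h3 := (EuclideanSpace.proj (𝕜 := ℝ) k).continuous.comp hw
  exact (h2.mul h3).smul h1

/-- The Leibniz rule for `q ↦ ∑ S_jk(q) X^j(q) Y^k(q)`. -/
theorem hasFDerivAt_extForm (hS : IsExtendedSecondFundamentalForm M S)
    {X Y : EuclideanSpace ℝ (Fin d) → EuclideanSpace ℝ (Fin d)}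
    {X' Y' : EuclideanSpace ℝ (Fin d) →L[ℝ] EuclideanSpace ℝ (Fin d)}
    {p : EuclideanSpace ℝ (Fin d)} (hX : HasFDerivAt X X' p) (hY : HasFDerivAt Y Y' p) :
    ∃ L : EuclideanSpace ℝ (Fin d) →L[ℝ] EuclideanSpace ℝ (Fin d),
      HasFDerivAt (fun q => extForm S q (X q) (Y q)) L p ∧
      ∀ z, L z = ∑ j, ∑ k, (X p j * Y p k) • fderiv ℝ (S j k) p z
        + (extForm S p (X' z) (Y p) + extForm S p (X p) (Y' z)) := by
  have hXj : ∀ j, HasFDerivAt (fun q => X q j) ((EuclideanSpace.proj (𝕜 := ℝ) j).comp X') p :=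
    fun j => (EuclideanSpace.proj (𝕜 := ℝ) j).hasFDerivAt.comp p hX
  have hYj : ∀ j, HasFDerivAt (fun q => Y q j) ((EuclideanSpace.proj (𝕜 := ℝ) j).comp Y') p :=
    fun j => (EuclideanSpace.proj (𝕜 := ℝ) j).hasFDerivAt.comp p hY
  have hSd : ∀ j k, HasFDerivAt (S j k) (fderiv ℝ (S j k) p) p := fun j k =>
    ((hS.contDiff j k).differentiable (by simp) p).hasFDerivAt
  refine ⟨_, HasFDerivAt.fun_sum fun j _ => HasFDerivAt.fun_sum fun k _ =>
    ((hXj j).mul (hYj k)).smul (hSd j k), fun z => ?_⟩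
  simp only [extForm, sum_apply, ← Finset.sum_add_distrib]
  refine Finset.sum_congr rfl fun j _ => Finset.sum_congr rfl fun k _ => ?_
  simp [add_smul, mul_comm]
  abel

theorem secondFundamentalForm_eq_neg_extForm (hS : IsExtendedSecondFundamentalForm M S)
    {p v w : EuclideanSpace ℝ (Fin d)} (hp : p ∈ M)
    (hv : v ∈ tangentSpaceOf M p) (hw : w ∈ tangentSpaceOf M p) :
    secondFundamentalForm M p v w = -extForm S p v w :=
  (hS.extends_form p hp v hv w hw).symm

theorem inner_secondFundamentalForm_eq_zero {p v w z : EuclideanSpace ℝ (Fin d)}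
    (hz : z ∈ tangentSpaceOf M p) : inner ℝ (secondFundamentalForm M p v w) z = 0 :=
  Submodule.starProjection_inner_eq_zero _ z hz

theorem inner_extForm_eq_zero (hS : IsExtendedSecondFundamentalForm M S)
    {p v w z : EuclideanSpace ℝ (Fin d)} (hp : p ∈ M)
    (hv : v ∈ tangentSpaceOf M p) (hw : w ∈ tangentSpaceOf M p) (hz : z ∈ tangentSpaceOf M p) :
    inner ℝ (extForm S p v w) z = 0 := by
  have := inner_secondFundamentalForm_eq_zero (v := v) (w := w) hz
  rwa [secondFundamentalForm_eq_neg_extForm hS hp hv hw, inner_neg_left, neg_eq_zero] at this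

/-- The tangential part of `∂S`: differentiate `⟨S_q(P_q v, P_q v), P_q w⟩ = 0` along `M` in the
direction `w`. -/
theorem inner_fderiv_extForm (hM : IsSmoothSubmanifold m M)
    (hS : IsExtendedSecondFundamentalForm M S) {p v w : EuclideanSpace ℝ (Fin d)} (hp : p ∈ M)
    (hv : v ∈ tangentSpaceOf M p) (hw : w ∈ tangentSpaceOf M p) :
    inner ℝ (∑ j, ∑ k, (v j * v k) • fderiv ℝ (S j k) p w) w
      = 2 * inner ℝ (extForm S p v (extForm S p v w)) w
        + inner ℝ (extForm S p v v) (extForm S p w w) := by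
  obtain ⟨U, Q, hpU, h⟩ := hM.exists_isProjExtension hp
  obtain ⟨L, hL, hLz⟩ := hasFDerivAt_extForm hS (h.hasFDerivAt_apply hpU v)
    (h.hasFDerivAt_apply hpU v)
  have h1 := (hL.inner ℝ (h.hasFDerivAt_apply hpU w)).eq_of_eqOn_tangent
    (hasFDerivAt_const (0 : ℝ) p) h.isOpen hpU hp (fun q hq => inner_extForm_eq_zero hS hq.1
      (h.apply_mem hq.1 hq.2 v) (h.apply_mem hq.1 hq.2 v) (h.apply_mem hq.1 hq.2 w)) hw
  have hwv : fderiv ℝ Q p w v = (-1 : ℝ) • extForm S p v w := by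
    rw [← h.secondFundamentalForm_eq hp hpU hw hv,
      secondFundamentalForm_eq_neg_extForm hS hp hw hv, extForm_symm hS, neg_one_smul]
  have hww : fderiv ℝ Q p w w = -extForm S p w w := by
    rw [← h.secondFundamentalForm_eq hp hpU hw hw, secondFundamentalForm_eq_neg_extForm hS hp hw hw]
  have hL2 := hLz w
  simp only [ContinuousLinearMap.flip_apply, h.apply_eq_self hp hpU hv, hwv] at hL2
  rw [extForm_symm hS p ((-1 : ℝ) • _) v, extForm_smul_right] at hL2
  have h2 : inner ℝ (extForm S p v v) (-extForm S p w w) + inner ℝ (L w) w = 0 := by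
    simpa [fderivInnerCLM_apply, h.apply_eq_self hp hpU hv, h.apply_eq_self hp hpU hw, hww] using h1
  rw [hL2, inner_add_left, inner_add_left, real_inner_smul_left, inner_neg_right] at h2
  linarith

/-- The tangential part of the lower order terms of the Jacobi operator. Here `w'` plays the role
of the derivative of a tangent field with value `w` along a curve with velocity `v`, so that its
normal part is `II(v,w)`. The terms quadratic in `S` cancel. -/
theorem inner_jacobi_lower_terms (hM : IsSmoothSubmanifold m M)
    (hS : IsExtendedSecondFundamentalForm M S) {p v w w' : EuclideanSpace ℝ (Fin d)} (hp : p ∈ M)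
    (hv : v ∈ tangentSpaceOf M p) (hw : w ∈ tangentSpaceOf M p)
    (hw' : w' = tangentProj M p w' - extForm S p v w) :
    inner ℝ (∑ j, ∑ k, (v j * v k) • fderiv ℝ (S j k) p w + (2 : ℝ) • extForm S p v w') w
      = inner ℝ (extForm S p v v) (extForm S p w w) := by
  have h1 : extForm S p v w' = extForm S p v (tangentProj M p w')
      + (-1 : ℝ) • extForm S p v (extForm S p v w) := by
    conv_lhs => rw [hw', sub_eq_add_neg, ← neg_one_smul ℝ (extForm S p v w)]
    rw [extForm_add_right, extForm_smul_right]
  rw [h1, inner_add_left, inner_fderiv_extForm hM hS hp hv hw, real_inner_smul_left,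
    inner_add_left, real_inner_smul_left,
    inner_extForm_eq_zero hS hp hv (tangentProj_mem p w') hw]
  ring

theorem sectionalCurvature_eq (hM : IsSmoothSubmanifold m M)
    (hS : IsExtendedSecondFundamentalForm M S) {p u v : EuclideanSpace ℝ (Fin d)} (hp : p ∈ M)
    (hu : u ∈ tangentSpaceOf M p) (hv : v ∈ tangentSpaceOf M p) :
    sectionalCurvature M p u v
      = (inner ℝ (extForm S p u u) (extForm S p v v) - ‖extForm S p u v‖ ^ 2)
        / (‖u‖ ^ 2 * ‖v‖ ^ 2 - inner ℝ u v ^ 2) := by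
  obtain ⟨U, Q, hpU, h⟩ := hM.exists_isProjExtension hp
  have e := fun {x y} hx hy =>
    secondFundamentalForm_eq_neg_extForm (v := x) (w := y) hS hp hx hy
  rw [sectionalCurvature, h.inner_curvature hp hpU hu hv
    (by rw [e hu hv, e hv hu, extForm_symm hS]), e hu hu, e hv hv, e hu hv, norm_neg,
    inner_neg_neg]

/-! ### The curvature term along a geodesic -/

/-- Minus the curvature `⟨R(v,w)v, w⟩`, in terms of the extended second fundamental form. -/
noncomputable def negCurvatureForm
    (S : Fin d → Fin d → EuclideanSpace ℝ (Fin d) → EuclideanSpace ℝ (Fin d))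
    (p v w : EuclideanSpace ℝ (Fin d)) : ℝ :=
  ‖extForm S p v w‖ ^ 2 - inner ℝ (extForm S p v v) (extForm S p w w)

theorem negCurvatureForm_smul_right (p v w : EuclideanSpace ℝ (Fin d)) (c : ℝ) :
    negCurvatureForm S p v (c • w) = c ^ 2 * negCurvatureForm S p v w := by
  simp only [negCurvatureForm, extForm_smul_right, extForm_smul_left, norm_smul,
    real_inner_smul_right, mul_pow, Real.norm_eq_abs, sq_abs]
  ring

theorem negCurvatureForm_smul_add (hS : IsExtendedSecondFundamentalForm M S)
    (p v w : EuclideanSpace ℝ (Fin d)) (c : ℝ) :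
    negCurvatureForm S p v (c • v + w) = negCurvatureForm S p v w := by
  simp only [negCurvatureForm, extForm_smul_right, extForm_smul_left, extForm_add_left,
    extForm_add_right, extForm_symm hS p w v, ← real_inner_self_eq_norm_sq, inner_add_left,
    inner_add_right, real_inner_smul_left, real_inner_smul_right,
    real_inner_comm (extForm S p v v) (extForm S p v w)]
  ring

theorem continuous_negCurvatureForm (hS : IsExtendedSecondFundamentalForm M S) {X : Type*}
    [TopologicalSpace X] {p v w : X → EuclideanSpace ℝ (Fin d)} (hp : Continuous p)
    (hv : Continuous v) (hw : Continuous w) :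
    Continuous fun x => negCurvatureForm S (p x) (v x) (w x) :=
  ((continuous_extForm hS hp hv hw).norm.pow 2).sub
    ((continuous_extForm hS hp hv hv).inner (continuous_extForm hS hp hw hw))

theorem negCurvatureForm_pos (hM : IsSmoothSubmanifold m M)
    (hS : IsExtendedSecondFundamentalForm M S) (hγM : ∀ x, γ x ∈ M)
    (hK : NegativeSectionalCurvatureOn M γ) {x : ℝ} {v w : EuclideanSpace ℝ (Fin d)}
    (hv : v ∈ tangentSpaceOf M (γ x)) (hw : w ∈ tangentSpaceOf M (γ x)) (hv0 : v ≠ 0)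
    (hw0 : w ≠ 0) (hvw : inner ℝ v w = 0) : 0 < negCurvatureForm S (γ x) v w := by
  have hli : LinearIndependent ℝ ![v, w] := by
    refine linearIndependent_of_ne_zero_of_inner_eq_zero (𝕜 := ℝ) ?_ ?_
    · intro i; fin_cases i <;> simpa
    · intro i j hij
      fin_cases i <;> fin_cases j <;> simp_all [real_inner_comm]
  have h1 := hK x v hv w hw hli
  rw [sectionalCurvature_eq hM hS (hγM x) hv hw, hvw] at h1
  have h2 : 0 < ‖v‖ ^ 2 * ‖w‖ ^ 2 - 0 ^ 2 := by
    have := norm_pos_iff.2 hv0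
    have := norm_pos_iff.2 hw0
    simp only [ne_eq, OfNat.ofNat_ne_zero, not_false_eq_true, zero_pow, sub_zero]
    positivity
  rw [div_lt_iff₀ h2, zero_mul] at h1
  rw [negCurvatureForm]
  linarith

theorem continuous_tangentProj_comp (hM : IsSmoothSubmanifold m M) (hγ : Continuous γ)
    (hγM : ∀ x, γ x ∈ M) : Continuous fun x => tangentProj M (γ x) := by
  refine continuous_iff_continuousAt.2 fun x => ?_
  obtain ⟨U, Q, hpU, h⟩ := hM.exists_isProjExtension (hγM x)
  have h1 : ContinuousAt (fun y => Q (γ y)) x :=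
    ContinuousAt.comp (h.hasFDerivAt hpU).continuousAt hγ.continuousAt
  refine h1.congr ?_
  filter_upwards [hγ.continuousAt.preimage_mem_nhds (h.isOpen.mem_nhds hpU)] with y hy
  exact h.eq_tangentProj _ ⟨hγM y, hy⟩

/-- By compactness, the curvature term is uniformly coercive on the tangent vectors orthogonal to a
nowhere vanishing tangent field along the curve. -/
theorem exists_negCurvatureForm_ge (hM : IsSmoothSubmanifold m M)
    (hS : IsExtendedSecondFundamentalForm M S) (hγ : Continuous γ) (hγM : ∀ x, γ x ∈ M)
    (hK : NegativeSectionalCurvatureOn M γ) {T : ℝ → EuclideanSpace ℝ (Fin d)} (hT : Continuous T)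
    (hTt : ∀ x, T x ∈ tangentSpaceOf M (γ x)) (hT0 : ∀ x, T x ≠ 0) (a b : ℝ) :
    ∃ κ : ℝ, 0 < κ ∧ ∀ x ∈ Set.Icc a b, ∀ w ∈ tangentSpaceOf M (γ x), inner ℝ (T x) w = 0 →
      κ * ‖w‖ ^ 2 ≤ negCurvatureForm S (γ x) (T x) w := by
  let C : Set (ℝ × EuclideanSpace ℝ (Fin d)) :=
    {z | z ∈ Set.Icc a b ×ˢ Metric.sphere 0 1 ∧ tangentProj M (γ z.1) z.2 = z.2 ∧
      inner ℝ (T z.1) z.2 = 0}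
  have hC : IsCompact C := by
    refine IsCompact.of_isClosed_subset
      (isCompact_Icc.prod (isCompact_sphere (0 : EuclideanSpace ℝ (Fin d)) 1)) ?_ fun z hz => hz.1
    refine (isClosed_Icc.prod Metric.isClosed_sphere).inter (IsClosed.inter ?_ ?_)
    · exact isClosed_eq (((continuous_tangentProj_comp hM hγ hγM).comp continuous_fst).clm_apply
        continuous_snd) continuous_snd
    · exact isClosed_eq ((hT.comp continuous_fst).inner continuous_snd) continuous_const
  have hf : Continuous fun z : ℝ × EuclideanSpace ℝ (Fin d) =>
      negCurvatureForm S (γ z.1) (T z.1) z.2 :=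
    continuous_negCurvatureForm hS (hγ.comp continuous_fst) (hT.comp continuous_fst) continuous_snd
  have hpos : ∀ z ∈ C, 0 < negCurvatureForm S (γ z.1) (T z.1) z.2 := by
    rintro ⟨x, w⟩ ⟨⟨-, hw1⟩, hw2, hw3⟩
    refine negCurvatureForm_pos hM hS hγM hK (hTt x) ?_ (hT0 x) ?_ hw3
    · rw [← hw2]; exact tangentProj_mem _ _
    · exact ne_zero_of_mem_unit_sphere ⟨w, hw1⟩
  obtain ⟨κ, hκ, hκC⟩ := hC.exists_forall_le' hf.continuousOn hpos
  refine ⟨κ, hκ, fun x hx w hw hTw => ?_⟩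
  rcases eq_or_ne w 0 with rfl | hw0
  · simp [negCurvatureForm, extForm]
  have hn : ‖w‖ ≠ 0 := norm_ne_zero_iff.2 hw0
  have hu := hκC (x, ‖w‖⁻¹ • w) ⟨⟨hx, by simp [norm_smul, hn]⟩, by
    simp [tangentProj_eq_self hw], by simp [real_inner_smul_right, hTw]⟩
  have hw1 : w = ‖w‖ • ‖w‖⁻¹ • w := by rw [smul_smul, mul_inv_cancel₀ hn, one_smul]
  rw [hw1, negCurvatureForm_smul_right, ← hw1, mul_comm]
  exact mul_le_mul_of_nonneg_left hu (sq_nonneg _)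

/-! ### Functions with a weak derivative on the circle -/

/-- A square integrable function on `(0, 2π]` that is orthogonal to all derivatives of smooth
periodic functions and has mean zero vanishes: its Fourier coefficients are zero. -/
theorem ae_eq_zero_of_integral_deriv_mul_eq_zero {g : ℝ → ℝ}
    (hg : MeasureTheory.MemLp g 2 (MeasureTheory.volume.restrict (Set.Ioc 0 (2 * Real.pi))))
    (h0 : ∫ x in (0 : ℝ)..2 * Real.pi, g x = 0)
    (h : ∀ η : ℝ → ℝ, ContDiff ℝ ∞ η → Function.Periodic η (2 * Real.pi) →
      ∫ x in (0 : ℝ)..2 * Real.pi, deriv η x * g x = 0) :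
    ∀ᵐ x ∂MeasureTheory.volume.restrict (Set.Ioc 0 (2 * Real.pi)), g x = 0 := by
  have hpi : (0 : ℝ) < 2 * Real.pi := Real.two_pi_pos
  have hgi : IntervalIntegrable g MeasureTheory.volume 0 (2 * Real.pi) :=
    (intervalIntegrable_iff_integrableOn_Ioc_of_le hpi.le).2 (hg.integrable (by norm_num))
  have hcos : ∀ n : ℤ, ∫ x in (0 : ℝ)..2 * Real.pi, Real.cos (n * x) * g x = 0 := by
    intro n
    rcases eq_or_ne n 0 with rfl | hn
    · simpa using h0
    have hn' : (n : ℝ) ≠ 0 := by exact_mod_cast hn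
    have := h (fun x => Real.sin (n * x) / n) (by fun_prop) (fun x => by
      simp only [mul_add, Real.sin_add_int_mul_two_pi])
    have hd : deriv (fun x : ℝ => Real.sin (n * x) / n) = fun x => Real.cos (n * x) := by
      funext x
      have h1 : HasDerivAt (fun x : ℝ => (n : ℝ) * x) n x := by
        simpa using (hasDerivAt_id x).const_mul (n : ℝ)
      rw [(h1.sin.div_const (n : ℝ)).deriv, mul_div_assoc, div_self hn', mul_one]
    rwa [hd] at this
  have hsin : ∀ n : ℤ, ∫ x in (0 : ℝ)..2 * Real.pi, Real.sin (n * x) * g x = 0 := by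
    intro n
    rcases eq_or_ne n 0 with rfl | hn
    · simp
    have hn' : (n : ℝ) ≠ 0 := by exact_mod_cast hn
    have := h (fun x => -Real.cos (n * x) / n) (by fun_prop) (fun x => by
      simp only [mul_add, Real.cos_add_int_mul_two_pi])
    have hd : deriv (fun x : ℝ => -Real.cos (n * x) / n) = fun x => Real.sin (n * x) := by
      funext x
      have h1 : HasDerivAt (fun x : ℝ => (n : ℝ) * x) n x := by
        simpa using (hasDerivAt_id x).const_mul (n : ℝ)
      rw [(h1.cos.fun_neg.div_const (n : ℝ)).deriv]
      field_simp
    rwa [hd] at this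
  have hcoeff : ∀ n : ℤ, fourierCoeffOn hpi (fun x => (g x : ℂ)) n = 0 := by
    intro n
    have h1 : ∀ x : ℝ, fourier (-n) (x : AddCircle (2 * Real.pi - 0)) • (g x : ℂ)
        = ((Real.cos (n * x) * g x : ℝ) : ℂ) - Complex.I * ((Real.sin (n * x) * g x : ℝ) : ℂ) := by
      intro x
      have h2 : (2 * (Real.pi : ℂ) * Complex.I * ((-n : ℤ) : ℂ) * (x : ℂ)
          / ((2 * Real.pi - 0 : ℝ) : ℂ)) = ((-(n * x) : ℝ) : ℂ) * Complex.I := by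
        have : (Real.pi : ℂ) ≠ 0 := by exact_mod_cast Real.pi_ne_zero
        push_cast
        field_simp
        ring
      rw [fourier_coe_apply, h2, Complex.exp_mul_I, ← Complex.ofReal_cos, ← Complex.ofReal_sin,
        Real.cos_neg, Real.sin_neg, smul_eq_mul]
      push_cast
      ring
    have hof : ∀ {u : ℝ → ℝ}, IntervalIntegrable u MeasureTheory.volume 0 (2 * Real.pi) →
        IntervalIntegrable (fun x => (u x : ℂ)) MeasureTheory.volume 0 (2 * Real.pi) :=
      fun hu => ⟨hu.1.ofReal, hu.2.ofReal⟩
    rw [fourierCoeffOn_eq_integral]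
    simp_rw [h1]
    rw [intervalIntegral.integral_sub, intervalIntegral.integral_const_mul,
      intervalIntegral.integral_ofReal, intervalIntegral.integral_ofReal, hcos, hsin]
    · simp
    · exact hof (hgi.continuousOn_mul (by fun_prop))
    · exact (hof (hgi.continuousOn_mul (by fun_prop))).const_mul _
  have hsum := hasSum_sq_fourierCoeffOn (f := fun x => (g x : ℂ)) hpi hg.ofReal
  simp only [hcoeff, norm_zero, ne_eq, OfNat.ofNat_ne_zero, not_false_eq_true, zero_pow] at hsum
  have h3 := hsum.unique hasSum_zero
  have h4 : ∫ x in Set.Ioc 0 (2 * Real.pi), g x ^ 2 = 0 := by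
    rw [intervalIntegral.integral_of_le hpi.le] at h3
    simpa [Real.pi_ne_zero] using h3
  have h5 := (MeasureTheory.integral_eq_zero_iff_of_nonneg (fun x => sq_nonneg (g x))
    hg.integrable_sq).1 h4
  filter_upwards [h5] with x hx
  simpa using hx

/-- A function on the circle with an integrable weak derivative is almost everywhere equal to an
absolutely continuous function, here extended to a continuous function on `ℝ`. -/
theorem exists_absolutelyContinuous_of_weakDeriv {f f' : ℝ → ℝ}
    (hf : MeasureTheory.MemLp f 2 (MeasureTheory.volume.restrict (Set.Ioc 0 (2 * Real.pi))))
    (hf' : IntervalIntegrable f' MeasureTheory.volume 0 (2 * Real.pi))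
    (h : ∀ η : ℝ → ℝ, ContDiff ℝ ∞ η → Function.Periodic η (2 * Real.pi) →
      ∫ x in (0 : ℝ)..2 * Real.pi, deriv η x * f x
        = -∫ x in (0 : ℝ)..2 * Real.pi, η x * f' x) :
    ∃ F : ℝ → ℝ, Continuous F ∧ AbsolutelyContinuousOnInterval F 0 (2 * Real.pi) ∧
      ∀ᵐ x ∂MeasureTheory.volume.restrict (Set.Ioc 0 (2 * Real.pi)),
        f x = F x ∧ HasDerivAt F (f' x) x := by
  have hpi : (0 : ℝ) < 2 * Real.pi := Real.two_pi_pos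
  -- cutting off `f'` makes the primitive continuous on `ℝ`
  let g : ℝ → ℝ := (Set.Ioc 0 (2 * Real.pi)).indicator f'
  have hg : MeasureTheory.Integrable g :=
    ((intervalIntegrable_iff_integrableOn_Ioc_of_le hpi.le).1 hf').integrable_indicator
      measurableSet_Ioc
  let G : ℝ → ℝ := fun x => ∫ t in (0 : ℝ)..x, g t
  have hGcont : Continuous G :=
    intervalIntegral.continuous_primitive (fun _ _ => hg.intervalIntegrable) 0
  have hG : AbsolutelyContinuousOnInterval G 0 (2 * Real.pi) :=
    hg.intervalIntegrable.absolutelyContinuousOnInterval_intervalIntegral (by simp)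
  have hGd : ∀ᵐ x ∂MeasureTheory.volume.restrict (Set.Ioc 0 (2 * Real.pi)),
      HasDerivAt G (f' x) x := by
    rw [MeasureTheory.ae_restrict_iff' measurableSet_Ioc]
    filter_upwards [(hg.intervalIntegrable (a := 0) (b := 2 * Real.pi)).ae_hasDerivAt_integral]
      with x hx hxI
    rw [← Set.indicator_of_mem hxI f']
    refine hx ?_ 0 (by simp)
    rw [Set.uIcc_of_le hpi.le]
    exact Set.Ioc_subset_Icc_self hxI
  have hG0 : G 0 = 0 := intervalIntegral.integral_same
  -- periodicity, from the constant test function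
  have hG1 : G (2 * Real.pi) = 0 := by
    have h1 := h (fun _ => 1) contDiff_const (fun _ => rfl)
    have h2 : G (2 * Real.pi) = ∫ t in (0 : ℝ)..2 * Real.pi, f' t := by
      simp only [G, g]
      rw [intervalIntegral.integral_of_le hpi.le, intervalIntegral.integral_of_le hpi.le]
      exact MeasureTheory.setIntegral_congr_fun measurableSet_Ioc fun t ht =>
        Set.indicator_of_mem ht f'
    rw [h2]
    simpa using h1
  have hfi : IntervalIntegrable f MeasureTheory.volume 0 (2 * Real.pi) :=
    (intervalIntegrable_iff_integrableOn_Ioc_of_le hpi.le).2 (hf.integrable (by norm_num))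
  have hGi : IntervalIntegrable G MeasureTheory.volume 0 (2 * Real.pi) :=
    hGcont.intervalIntegrable _ _
  have hGLp : MeasureTheory.MemLp G 2
      (MeasureTheory.volume.restrict (Set.Ioc 0 (2 * Real.pi))) := by
    obtain ⟨C, hC⟩ := isCompact_Icc.exists_bound_of_continuousOn hGcont.continuousOn
    refine MeasureTheory.MemLp.of_bound hGcont.aestronglyMeasurable C ?_
    rw [MeasureTheory.ae_restrict_iff' measurableSet_Ioc]
    exact Filter.Eventually.of_forall fun x hx => hC x (Set.Ioc_subset_Icc_self hx)
  let c : ℝ := (2 * Real.pi)⁻¹ * ∫ x in (0 : ℝ)..2 * Real.pi, (f x - G x)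
  have hz := ae_eq_zero_of_integral_deriv_mul_eq_zero (g := fun x => f x - G x - c)
    ((hf.sub hGLp).sub (MeasureTheory.memLp_const c)) (by
      rw [intervalIntegral.integral_sub (hfi.sub hGi) (by simp), intervalIntegral.integral_const,
        smul_eq_mul, sub_zero, ← mul_assoc, mul_inv_cancel₀ hpi.ne', one_mul, sub_self]) (by
      intro η hη hηp
      have hη1 : Continuous (deriv η) := hη.continuous_deriv (by simp)
      have hηA : AbsolutelyContinuousOnInterval η 0 (2 * Real.pi) :=
        (hη.of_le (by simp)).contDiffOn.absolutelyContinuousOnInterval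
      have h1 := hηA.integral_deriv_mul_eq_sub hG
      have hd : ∫ x in (0 : ℝ)..2 * Real.pi, deriv η x * G x + η x * deriv G x
          = ∫ x in (0 : ℝ)..2 * Real.pi, deriv η x * G x + η x * f' x := by
        rw [intervalIntegral.integral_of_le hpi.le, intervalIntegral.integral_of_le hpi.le]
        refine MeasureTheory.integral_congr_ae ?_
        filter_upwards [hGd] with x hx
        rw [hx.deriv]
      have hi1 := hGi.continuousOn_mul hη1.continuousOn
      have hi2 := hf'.continuousOn_mul hη.continuous.continuousOn
      have hi3 := hfi.continuousOn_mul hη1.continuousOn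
      have hi4 : IntervalIntegrable (fun x => deriv η x * c) MeasureTheory.volume 0 (2 * Real.pi) :=
        (hη1.mul continuous_const).intervalIntegrable _ _
      rw [hd, hG0, hG1, mul_zero, mul_zero, sub_zero, intervalIntegral.integral_add hi1 hi2] at h1
      have h2 := hηA.integral_deriv_eq_sub
      have h3 : η (2 * Real.pi) = η 0 := by simpa using hηp 0
      rw [h3, sub_self] at h2
      simp only [mul_sub]
      rw [intervalIntegral.integral_sub (hi3.sub hi1) hi4, intervalIntegral.integral_sub hi3 hi1,
        intervalIntegral.integral_mul_const, h2, h η hη hηp]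
      linarith)
  refine ⟨fun x => G x + c, hGcont.add continuous_const, hG.fun_add
    (contDiff_const.contDiffOn.absolutelyContinuousOnInterval), ?_⟩
  filter_upwards [hz, hGd] with x hx hx'
  exact ⟨by linarith, hx'.add_const c⟩

theorem exists_absolutelyContinuous_of_isWeakDerivCircle {d : ℕ}
    {φ φ' : ℝ → EuclideanSpace ℝ (Fin d)}
    (hφ : MeasureTheory.MemLp φ 2 (MeasureTheory.volume.restrict (Set.Ioc 0 (2 * Real.pi))))
    (hφ' : MeasureTheory.MemLp φ' 2 (MeasureTheory.volume.restrict (Set.Ioc 0 (2 * Real.pi))))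
    (h : IsWeakDerivCircle φ φ') :
    ∃ F : ℝ → EuclideanSpace ℝ (Fin d), Continuous F ∧
      (∀ i, AbsolutelyContinuousOnInterval (fun x => F x i) 0 (2 * Real.pi)) ∧
      ∀ᵐ x ∂MeasureTheory.volume.restrict (Set.Ioc 0 (2 * Real.pi)),
        φ x = F x ∧ HasDerivAt F (φ' x) x := by
  have hpi : (0 : ℝ) < 2 * Real.pi := Real.two_pi_pos
  have hint : ∀ {f : ℝ → EuclideanSpace ℝ (Fin d)},
      MeasureTheory.MemLp f 2 (MeasureTheory.volume.restrict (Set.Ioc 0 (2 * Real.pi))) →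
      IntervalIntegrable f MeasureTheory.volume 0 (2 * Real.pi) := fun hf =>
    (intervalIntegrable_iff_integrableOn_Ioc_of_le hpi.le).2 (hf.integrable (by norm_num))
  have hcomp : ∀ i, ∃ F : ℝ → ℝ, Continuous F ∧ AbsolutelyContinuousOnInterval F 0 (2 * Real.pi) ∧
      ∀ᵐ x ∂MeasureTheory.volume.restrict (Set.Ioc 0 (2 * Real.pi)),
        φ x i = F x ∧ HasDerivAt F (φ' x i) x := by
    intro i
    let L : EuclideanSpace ℝ (Fin d) →L[ℝ] ℝ := EuclideanSpace.proj i
    have hL : ∀ {f : ℝ → EuclideanSpace ℝ (Fin d)},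
        IntervalIntegrable f MeasureTheory.volume 0 (2 * Real.pi) →
        IntervalIntegrable (fun x => L (f x)) MeasureTheory.volume 0 (2 * Real.pi) := fun hf =>
      ⟨L.integrable_comp hf.1, L.integrable_comp hf.2⟩
    refine exists_absolutelyContinuous_of_weakDeriv (L.comp_memLp' hφ) (hL (hint hφ'))
      fun η hη hηp => ?_
    have h1 := congrArg L (h η hη hηp)
    rw [map_neg, ← L.intervalIntegral_comp_comm, ← L.intervalIntegral_comp_comm] at h1
    · simpa [L] using h1
    · exact (hint hφ').continuousOn_smul hη.continuous.continuousOn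
    · exact (hint hφ).continuousOn_smul (hη.continuous_deriv (by simp)).continuousOn
  choose F hF0 hF1 hF2 using hcomp
  refine ⟨fun x => WithLp.toLp 2 fun i => F i x,
    (PiLp.continuous_toLp 2 _).comp (continuous_pi hF0), fun i => hF1 i, ?_⟩
  filter_upwards [MeasureTheory.ae_all_iff.2 hF2] with x hx
  refine ⟨PiLp.ext fun i => (hx i).1, ?_⟩
  have h2 : HasDerivAt (fun x i => F i x) (fun i => φ' x i) x := hasDerivAt_pi.2 fun i => (hx i).2
  exact (EuclideanSpace.equiv (Fin d) ℝ).symm.hasFDerivAt.comp_hasDerivAt x h2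

/-- The Poincaré inequality for absolutely continuous functions of mean zero on an interval. -/
theorem AbsolutelyContinuousOnInterval.integral_sq_le {a : ℝ → ℝ} {l : ℝ} (hl : 0 < l)
    (ha : AbsolutelyContinuousOnInterval a 0 l) (h0 : ∫ x in (0 : ℝ)..l, a x = 0)
    (hsq : IntervalIntegrable (fun x => deriv a x ^ 2) MeasureTheory.volume 0 l) :
    ∫ x in (0 : ℝ)..l, a x ^ 2 ≤ l ^ 2 * ∫ x in (0 : ℝ)..l, deriv a x ^ 2 := by
  have hi : IntervalIntegrable (fun x => |deriv a x|) MeasureTheory.volume 0 l :=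
    ha.intervalIntegrable_deriv.abs
  have hac : ContinuousOn a (Set.uIcc 0 l) := ha.continuousOn
  set K := ∫ x in (0 : ℝ)..l, |deriv a x| with hK
  have hosc : ∀ x ∈ Set.Icc 0 l, ∀ y ∈ Set.Icc 0 l, |a x - a y| ≤ K := by
    intro x hx y hy
    have hsub : Set.uIcc y x ⊆ Set.uIcc 0 l := by
      rw [Set.uIcc_of_le hl.le]; exact Set.uIcc_subset_Icc hy hx
    rw [← (ha.mono hsub).integral_deriv_eq_sub, ← Real.norm_eq_abs]
    refine (intervalIntegral.norm_integral_le_integral_norm_uIoc).trans ?_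
    rw [hK, intervalIntegral.integral_of_le hl.le]
    have hsub' : Set.uIoc y x ⊆ Set.Ioc 0 l := fun t ht =>
      ⟨(le_min hy.1 hx.1).trans_lt ht.1, ht.2.trans (max_le hy.2 hx.2)⟩
    exact MeasureTheory.setIntegral_mono_set hi.1
      (Filter.Eventually.of_forall fun x => abs_nonneg _) hsub'.eventuallyLE
  -- as `a` has mean zero, `l a(x)` is the integral of `a(x) - a(y)` over `y`
  have hsup : ∀ x ∈ Set.Icc 0 l, a x ^ 2 ≤ K ^ 2 := by
    intro x hx
    have h1 : ∫ y in (0 : ℝ)..l, (a x - a y) = l * a x := by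
      rw [intervalIntegral.integral_sub (by simp) hac.intervalIntegrable, h0]
      simp
    have h2 : ‖∫ y in (0 : ℝ)..l, (a x - a y)‖ ≤ K * |l - 0| := by
      refine intervalIntegral.norm_integral_le_of_norm_le_const fun y hy => ?_
      rw [Set.uIoc_of_le hl.le] at hy
      exact hosc x hx y (Set.Ioc_subset_Icc_self hy)
    rw [h1, Real.norm_eq_abs, abs_mul, abs_of_pos hl, sub_zero, abs_of_pos hl, mul_comm] at h2
    have h3 := le_of_mul_le_mul_right h2 hl
    rw [← sq_abs]
    exact pow_le_pow_left₀ (abs_nonneg _) h3 2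
  -- Cauchy-Schwarz, from the variance of `|a'|`
  have hCS : K ^ 2 ≤ l * ∫ x in (0 : ℝ)..l, deriv a x ^ 2 := by
    have h1 : 0 ≤ ∫ x in (0 : ℝ)..l, (|deriv a x| - K / l) ^ 2 :=
      intervalIntegral.integral_nonneg hl.le fun x _ => sq_nonneg _
    have h2 : ∀ x, (|deriv a x| - K / l) ^ 2
        = deriv a x ^ 2 - 2 * (K / l) * |deriv a x| + (K / l) ^ 2 := fun x => by
      rw [sub_sq, sq_abs]; ring
    simp_rw [h2] at h1
    rw [intervalIntegral.integral_add (hsq.sub (hi.const_mul _)) (by simp),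
      intervalIntegral.integral_sub hsq (hi.const_mul _), intervalIntegral.integral_const_mul,
      ← hK, intervalIntegral.integral_const, smul_eq_mul, sub_zero] at h1
    have h3 : l * (∫ x in (0 : ℝ)..l, deriv a x ^ 2) - K ^ 2
        = l * ((∫ x in (0 : ℝ)..l, deriv a x ^ 2) - 2 * (K / l) * K + l * (K / l) ^ 2) := by
      field_simp
      ring
    nlinarith [mul_nonneg hl.le h1]
  calc ∫ x in (0 : ℝ)..l, a x ^ 2 ≤ ∫ x in (0 : ℝ)..l, K ^ 2 :=
        intervalIntegral.integral_mono_on hl.le (hac.pow 2).intervalIntegrable (by simp) hsup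
    _ = l * K ^ 2 := by simp
    _ ≤ l * (l * ∫ x in (0 : ℝ)..l, deriv a x ^ 2) := by gcongr
    _ = _ := by ring

variable {φ φ' : ℝ → EuclideanSpace ℝ (Fin d)}

/-! ### Tangent fields along a geodesic -/

theorem IsClosedGeodesic.contDiff_deriv (hγ : IsClosedGeodesic M γ) : ContDiff ℝ 1 (deriv γ) :=
  ((contDiff_succ_iff_deriv (n := 1)).1 hγ.contDiff).2.2

theorem IsClosedGeodesic.deriv_mem (hγ : IsClosedGeodesic M γ) (x : ℝ) :
    deriv γ x ∈ tangentSpaceOf M (γ x) :=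
  deriv_mem_tangentSpaceOf hγ.mem (hγ.contDiff.differentiable (by norm_num) x)

theorem IsClosedGeodesic.hasDerivAt_deriv (hγ : IsClosedGeodesic M γ) (x : ℝ) :
    HasDerivAt (deriv γ) (deriv (deriv γ) x) x :=
  (hγ.contDiff_deriv.differentiable (by norm_num) x).hasDerivAt

theorem IsClosedGeodesic.inner_deriv_deriv_eq_zero (hγ : IsClosedGeodesic M γ) {x : ℝ}
    {z : EuclideanSpace ℝ (Fin d)} (hz : z ∈ tangentSpaceOf M (γ x)) :
    inner ℝ (deriv (deriv γ) x) z = 0 := by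
  rw [hγ.eqn]
  exact inner_secondFundamentalForm_eq_zero hz

theorem IsClosedGeodesic.norm_deriv_sq_eq (hγ : IsClosedGeodesic M γ) (x y : ℝ) :
    ‖deriv γ x‖ ^ 2 = ‖deriv γ y‖ ^ 2 := by
  have h1 : ∀ x, HasDerivAt (fun x => ‖deriv γ x‖ ^ 2) 0 x := fun x => by
    have := (hγ.hasDerivAt_deriv x).norm_sq
    rwa [real_inner_comm, hγ.inner_deriv_deriv_eq_zero (hγ.deriv_mem x), mul_zero] at this
  exact is_const_of_deriv_eq_zero (fun x => (h1 x).differentiableAt) (fun x => (h1 x).deriv) x y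

/-- The derivative of a tangent field along a curve has normal part `II(γ', F)`: differentiate
`P_γ F = F`. -/
theorem eq_tangentProj_sub_extForm_of_hasDerivAt (hM : IsSmoothSubmanifold m M)
    (hS : IsExtendedSecondFundamentalForm M S) (hγM : ∀ x, γ x ∈ M) {x : ℝ}
    {F : ℝ → EuclideanSpace ℝ (Fin d)} {F' : EuclideanSpace ℝ (Fin d)}
    (hγ : DifferentiableAt ℝ γ x) (hF : HasDerivAt F F' x)
    (hFt : ∀ᶠ y in nhds x, F y ∈ tangentSpaceOf M (γ y)) :
    F' = tangentProj M (γ x) F' - extForm S (γ x) (deriv γ x) (F x) := by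
  obtain ⟨U, Q, hpU, h⟩ := hM.exists_isProjExtension (hγM x)
  have hv := deriv_mem_tangentSpaceOf hγM hγ
  have hFx : F x ∈ tangentSpaceOf M (γ x) := hFt.self_of_nhds
  have h1 : HasDerivAt (fun y => Q (γ y)) (fderiv ℝ Q (γ x) (deriv γ x)) x :=
    (h.hasFDerivAt hpU).comp_hasDerivAt x hγ.hasDerivAt
  have h2 : F =ᶠ[nhds x] fun y => Q (γ y) (F y) := by
    filter_upwards [hFt, hγ.continuousAt.preimage_mem_nhds (h.isOpen.mem_nhds hpU)] with y hy hyU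
    exact (h.apply_eq_self (hγM y) hyU hy).symm
  have h3 := hF.unique ((h1.clm_apply hF).congr_of_eventuallyEq h2)
  rw [← h.secondFundamentalForm_eq (hγM x) hpU hv hFx,
    secondFundamentalForm_eq_neg_extForm hS (hγM x) hv hFx,
    h.eq_tangentProj _ ⟨hγM x, hpU⟩, neg_add_eq_sub] at h3
  exact h3

/-- `F` is an absolutely continuous representative of the tangent field `φ` along `γ` with weak
derivative `φ'`, whose derivative has normal part `II(γ', F)`. -/
structure IsACRepresentative (M : Set (EuclideanSpace ℝ (Fin d)))
    (S : Fin d → Fin d → EuclideanSpace ℝ (Fin d) → EuclideanSpace ℝ (Fin d))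
    (γ φ φ' F : ℝ → EuclideanSpace ℝ (Fin d)) : Prop where
  continuous : Continuous F
  absolutelyContinuous : ∀ i, AbsolutelyContinuousOnInterval (fun x => F x i) 0 (2 * Real.pi)
  ae : ∀ᵐ x ∂MeasureTheory.volume.restrict (Set.Ioc 0 (2 * Real.pi)),
    φ x = F x ∧ F x ∈ tangentSpaceOf M (γ x) ∧ HasDerivAt F (φ' x) x ∧
      φ' x = tangentProj M (γ x) (φ' x) - extForm S (γ x) (deriv γ x) (F x)

theorem IsH1TangentField.exists_isACRepresentative (hM : IsSmoothSubmanifold m M)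
    (hS : IsExtendedSecondFundamentalForm M S) (hγ : Differentiable ℝ γ) (hγM : ∀ x, γ x ∈ M)
    (h : IsH1TangentField M γ φ φ') : ∃ F, IsACRepresentative M S γ φ φ' F := by
  obtain ⟨F, hFc, hFa, hF⟩ := exists_absolutelyContinuous_of_isWeakDerivCircle h.memLp h.memLp'
    h.weakDeriv
  have hP := continuous_tangentProj_comp hM hγ.continuous hγM
  rw [← MeasureTheory.Measure.restrict_congr_set MeasureTheory.Ioo_ae_eq_Ioc] at hF
  have htan : ∀ x ∈ Set.Ioo 0 (2 * Real.pi), F x ∈ tangentSpaceOf M (γ x) := by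
    have h1 : (fun x => tangentProj M (γ x) (F x))
        =ᵐ[MeasureTheory.volume.restrict (Set.Ioo 0 (2 * Real.pi))] F := by
      filter_upwards [hF, MeasureTheory.ae_restrict_of_ae h.tangent] with x hx hxt
      rw [← hx.1, tangentProj_eq_self hxt]
    have h2 := MeasureTheory.Measure.eqOn_open_of_ae_eq h1 isOpen_Ioo
      (hP.clm_apply hFc).continuousOn hFc.continuousOn
    intro x hx
    rw [← h2 hx]
    exact tangentProj_mem _ _
  refine ⟨F, ⟨hFc, hFa, ?_⟩⟩
  rw [← MeasureTheory.Measure.restrict_congr_set MeasureTheory.Ioo_ae_eq_Ioc]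
  filter_upwards [hF, MeasureTheory.ae_restrict_mem measurableSet_Ioo] with x hx hxI
  exact ⟨hx.1, htan x hxI, hx.2, eq_tangentProj_sub_extForm_of_hasDerivAt hM hS hγM (hγ x)
    hx.2 (Filter.mem_of_superset (isOpen_Ioo.mem_nhds hxI) htan)⟩

theorem exists_norm_extForm_le (hS : IsExtendedSecondFundamentalForm M S)
    {p v : ℝ → EuclideanSpace ℝ (Fin d)} (hp : Continuous p) (hv : Continuous v) (a b : ℝ) :
    ∃ B : ℝ, 0 ≤ B ∧ ∀ x ∈ Set.Icc a b, ∀ w, ‖extForm S (p x) (v x) w‖ ^ 2 ≤ B * ‖w‖ ^ 2 := by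
  have hc : Continuous fun x => ∑ j, ∑ k, ‖v x‖ * ‖S j k (p x)‖ :=
    continuous_finsetSum _ fun j _ => continuous_finsetSum _ fun k _ =>
      hv.norm.mul ((hS.contDiff j k).continuous.comp hp).norm
  obtain ⟨C, hC⟩ := isCompact_Icc.exists_bound_of_continuousOn (s := Set.Icc a b) hc.continuousOn
  refine ⟨C ^ 2, sq_nonneg C, fun x hx w => ?_⟩
  have h1 : ‖extForm S (p x) (v x) w‖ ≤ C * ‖w‖ := by
    calc ‖extForm S (p x) (v x) w‖
        ≤ ∑ j, ∑ k, ‖(v x j * w k) • S j k (p x)‖ :=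
          (norm_sum_le _ _).trans (Finset.sum_le_sum fun j _ => norm_sum_le _ _)
      _ ≤ ∑ j, ∑ k, (‖v x‖ * ‖S j k (p x)‖) * ‖w‖ := by
          refine Finset.sum_le_sum fun j _ => Finset.sum_le_sum fun k _ => ?_
          rw [norm_smul, norm_mul, mul_right_comm ‖v x‖]
          gcongr
          · exact PiLp.norm_apply_le (v x) j
          · exact PiLp.norm_apply_le w k
      _ = (∑ j, ∑ k, ‖v x‖ * ‖S j k (p x)‖) * ‖w‖ := by simp only [Finset.sum_mul]
      _ ≤ C * ‖w‖ := by
          gcongr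
          exact (le_abs_self _).trans (hC x hx)
  rw [← mul_pow]
  exact pow_le_pow_left₀ (norm_nonneg _) h1 2

/-- Splitting a tangent vector into its components along and orthogonal to `v`; only the latter
contributes to the curvature term. -/
theorem norm_sq_le_of_negCurvatureForm_ge (hS : IsExtendedSecondFundamentalForm M S)
    {p v w : EuclideanSpace ℝ (Fin d)} (hv : v ∈ tangentSpaceOf M p)
    (hw : w ∈ tangentSpaceOf M p) (hv0 : v ≠ 0) {κ : ℝ} (hκ : 0 < κ)
    (h : ∀ z ∈ tangentSpaceOf M p, inner ℝ v z = 0 → κ * ‖z‖ ^ 2 ≤ negCurvatureForm S p v z) :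
    0 ≤ negCurvatureForm S p v w ∧
      ‖w‖ ^ 2 ≤ (‖v‖ ^ 2)⁻¹ * inner ℝ w v ^ 2 + κ⁻¹ * negCurvatureForm S p v w := by
  have hn : ‖v‖ ^ 2 ≠ 0 := pow_ne_zero 2 (norm_ne_zero_iff.2 hv0)
  set t : ℝ := (‖v‖ ^ 2)⁻¹ * inner ℝ w v with ht
  set z := w - t • v with hz
  have hzt : z ∈ tangentSpaceOf M p := Submodule.sub_mem _ hw (Submodule.smul_mem _ _ hv)
  have hvz : inner ℝ v z = 0 := by
    rw [hz, inner_sub_right, real_inner_smul_right, real_inner_self_eq_norm_sq, ht,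
      real_inner_comm v w]
    field_simp
    ring
  have hw' : w = t • v + z := by rw [hz]; abel
  have hN : negCurvatureForm S p v w = negCurvatureForm S p v z := by
    rw [hw', negCurvatureForm_smul_add hS]
  have hnorm : ‖w‖ ^ 2 = (‖v‖ ^ 2)⁻¹ * inner ℝ w v ^ 2 + ‖z‖ ^ 2 := by
    have h1 : ‖t • v + z‖ ^ 2 = t ^ 2 * ‖v‖ ^ 2 + ‖z‖ ^ 2 := by
      rw [norm_add_sq_real, real_inner_smul_left, hvz, norm_smul, mul_pow, Real.norm_eq_abs, sq_abs]
      ring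
    conv_lhs => rw [hw', h1, ht]
    field_simp
  have hz1 := h z hzt hvz
  rw [hnorm, hN]
  refine ⟨le_trans (by positivity) hz1, ?_⟩
  gcongr
  rw [inv_mul_eq_div, le_div_iff₀ hκ, mul_comm]
  exact hz1

theorem absolutelyContinuousOnInterval_inner {F T : ℝ → EuclideanSpace ℝ (Fin d)} {a b : ℝ}
    (hF : ∀ i, AbsolutelyContinuousOnInterval (fun x => F x i) a b)
    (hT : ∀ i, AbsolutelyContinuousOnInterval (fun x => T x i) a b) :
    AbsolutelyContinuousOnInterval (fun x => (inner ℝ (F x) (T x) : ℝ)) a b := by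
  have hsum : ∀ s : Finset (Fin d),
      AbsolutelyContinuousOnInterval (fun x => ∑ i ∈ s, T x i * F x i) a b := by
    intro s
    induction s using Finset.induction_on with
    | empty => simpa using (contDiff_const (c := (0 : ℝ))).contDiffOn.absolutelyContinuousOnInterval
    | insert i s hi ih =>
      simp only [Finset.sum_insert hi]
      exact ((hT i).fun_mul (hF i)).fun_add ih
  simpa [PiLp.inner_apply] using hsum Finset.univ

/-! ### The second variation and the Poincaré inequality -/

theorem integrable_restrict_Ioc_of_continuous {f : ℝ → ℝ} (hf : Continuous f) (a b : ℝ) :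
    MeasureTheory.Integrable f (MeasureTheory.volume.restrict (Set.Ioc a b)) :=
  hf.integrableOn_Icc.mono_set Set.Ioc_subset_Icc_self

namespace IsACRepresentative

variable {F : ℝ → EuclideanSpace ℝ (Fin d)}

theorem integrable_tangentialPart (hS : IsExtendedSecondFundamentalForm M S)
    (hγ : IsClosedGeodesic M γ) (h : IsH1TangentField M γ φ φ')
    (hF : IsACRepresentative M S γ φ φ' F) :
    MeasureTheory.Integrable
      (fun x => ‖φ' x‖ ^ 2 - ‖extForm S (γ x) (deriv γ x) (F x)‖ ^ 2)
      (MeasureTheory.volume.restrict (Set.Ioc 0 (2 * Real.pi))) :=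
  (h.memLp'.integrable_norm_pow two_ne_zero).sub (integrable_restrict_Ioc_of_continuous
    ((continuous_extForm hS hγ.contDiff.continuous hγ.contDiff_deriv.continuous
      hF.continuous).norm.pow 2) _ _)

/-- The second variation formula `-⟨L φ, φ⟩ = ∫ |P φ'|² - ∫ ⟨R(γ',φ)γ', φ⟩`. Here `|P φ'|²` is
written as `|φ'|² - |II(γ',φ)|²`. -/
theorem neg_jacobiPairing_eq (hM : IsSmoothSubmanifold m M)
    (hS : IsExtendedSecondFundamentalForm M S)
    (hγ : IsClosedGeodesic M γ) (h : IsH1TangentField M γ φ φ')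
    (hF : IsACRepresentative M S γ φ φ' F) :
    -jacobiPairing S γ φ φ' φ φ'
      = (∫ x in Set.Ioc 0 (2 * Real.pi),
          (‖φ' x‖ ^ 2 - ‖extForm S (γ x) (deriv γ x) (F x)‖ ^ 2))
        + ∫ x in Set.Ioc 0 (2 * Real.pi), negCurvatureForm S (γ x) (deriv γ x) (F x) := by
  have hpi : (0 : ℝ) < 2 * Real.pi := Real.two_pi_pos
  have hvc := hγ.contDiff_deriv.continuous
  have hγc := hγ.contDiff.continuous
  have hFc := hF.continuous
  have h1 : ∫ x in (0 : ℝ)..2 * Real.pi, inner ℝ (jacobiLower S γ φ φ' x) (φ x)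
      = ∫ x in Set.Ioc 0 (2 * Real.pi), inner ℝ (extForm S (γ x) (deriv γ x) (deriv γ x))
          (extForm S (γ x) (F x) (F x)) := by
    rw [intervalIntegral.integral_of_le hpi.le]
    refine MeasureTheory.integral_congr_ae ?_
    filter_upwards [hF.ae] with x ⟨hx1, hx2, _, hx4⟩
    rw [← inner_jacobi_lower_terms hM hS (hγ.mem x) (hγ.deriv_mem x) hx2 hx4, ← hx1]
    rfl
  have hRc : Continuous fun x => (inner ℝ (extForm S (γ x) (deriv γ x) (deriv γ x))
      (extForm S (γ x) (F x) (F x)) : ℝ) :=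
    (continuous_extForm hS hγc hvc hvc).inner (continuous_extForm hS hγc hFc hFc)
  have hE : MeasureTheory.Integrable (fun x => ‖φ' x‖ ^ 2)
      (MeasureTheory.volume.restrict (Set.Ioc 0 (2 * Real.pi))) :=
    h.memLp'.integrable_norm_pow two_ne_zero
  rw [jacobiPairing, h1, ← MeasureTheory.integral_add (hF.integrable_tangentialPart hS hγ h)
    (integrable_restrict_Ioc_of_continuous (continuous_negCurvatureForm hS hγc hvc hFc) _ _),
    intervalIntegral.integral_of_le hpi.le]
  simp only [real_inner_self_eq_norm_sq, negCurvatureForm, sub_add_sub_cancel]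
  rw [MeasureTheory.integral_sub hE (integrable_restrict_Ioc_of_continuous hRc _ _)]
  ring

/-- As `γ''` is normal, `⟨F, γ'⟩' = ⟨P φ', γ'⟩`. -/
theorem deriv_inner_sq_le (hS : IsExtendedSecondFundamentalForm M S)
    (hγ : IsClosedGeodesic M γ) (hF : IsACRepresentative M S γ φ φ' F) :
    ∀ᵐ x ∂MeasureTheory.volume.restrict (Set.Ioc 0 (2 * Real.pi)),
      deriv (fun x => (inner ℝ (F x) (deriv γ x) : ℝ)) x ^ 2
        ≤ ‖deriv γ 0‖ ^ 2 * (‖φ' x‖ ^ 2 - ‖extForm S (γ x) (deriv γ x) (F x)‖ ^ 2) := by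
  filter_upwards [hF.ae] with x ⟨_, hx2, hx3, hx4⟩
  have hpyth : ‖φ' x‖ ^ 2 - ‖extForm S (γ x) (deriv γ x) (F x)‖ ^ 2
      = ‖tangentProj M (γ x) (φ' x)‖ ^ 2 := by
    have h1 := inner_extForm_eq_zero hS (hγ.mem x) (hγ.deriv_mem x) hx2
      (tangentProj_mem (γ x) (φ' x))
    conv_lhs => rw [hx4]
    rw [norm_sub_sq_real, real_inner_comm, h1]
    ring
  have h1 := (hx3.inner ℝ (hγ.hasDerivAt_deriv x)).deriv
  rw [real_inner_comm, hγ.inner_deriv_deriv_eq_zero hx2, zero_add] at h1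
  have h2 : inner ℝ (φ' x) (deriv γ x) = inner ℝ (tangentProj M (γ x) (φ' x)) (deriv γ x) := by
    rw [inner_tangentProj_left, tangentProj_eq_self (hγ.deriv_mem x)]
  rw [h1, h2, hpyth, hγ.norm_deriv_sq_eq 0 x, ← mul_pow, ← sq_abs, mul_comm]
  exact pow_le_pow_left₀ (abs_nonneg _) (abs_real_inner_le_norm _ _) 2

/-- The Poincaré inequality for the component of a tangent field along the geodesic. -/
theorem integral_inner_sq_le (hS : IsExtendedSecondFundamentalForm M S)
    (hγ : IsClosedGeodesic M γ) (h : IsH1TangentField M γ φ φ')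
    (hF : IsACRepresentative M S γ φ φ' F)
    (hmean : (∫ x in (0 : ℝ)..2 * Real.pi, inner ℝ (φ x) (deriv γ x)) = 0) :
    ∫ x in Set.Ioc 0 (2 * Real.pi), inner ℝ (F x) (deriv γ x) ^ 2
      ≤ (2 * Real.pi) ^ 2 * (‖deriv γ 0‖ ^ 2 * ∫ x in Set.Ioc 0 (2 * Real.pi),
          (‖φ' x‖ ^ 2 - ‖extForm S (γ x) (deriv γ x) (F x)‖ ^ 2)) := by
  have hpi : (0 : ℝ) < 2 * Real.pi := Real.two_pi_pos
  have hder := hF.deriv_inner_sq_le hS hγ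
  have hDi := (hF.integrable_tangentialPart hS hγ h).const_mul (‖deriv γ 0‖ ^ 2)
  have hdi : MeasureTheory.Integrable
      (fun x => deriv (fun x => (inner ℝ (F x) (deriv γ x) : ℝ)) x ^ 2)
      (MeasureTheory.volume.restrict (Set.Ioc 0 (2 * Real.pi))) := by
    refine hDi.mono' ((measurable_deriv _).pow_const 2).aestronglyMeasurable ?_
    filter_upwards [hder] with x hx
    rwa [Real.norm_eq_abs, abs_of_nonneg (sq_nonneg _)]
  have hdle := MeasureTheory.integral_mono_ae hdi hDi hder
  rw [MeasureTheory.integral_const_mul] at hdle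
  have ha : AbsolutelyContinuousOnInterval (fun x => (inner ℝ (F x) (deriv γ x) : ℝ)) 0
      (2 * Real.pi) :=
    absolutelyContinuousOnInterval_inner hF.absolutelyContinuous fun i =>
      (((EuclideanSpace.proj (𝕜 := ℝ) i).contDiff.comp
        hγ.contDiff_deriv).contDiffOn).absolutelyContinuousOnInterval
  have hmean' : ∫ x in (0 : ℝ)..2 * Real.pi, (inner ℝ (F x) (deriv γ x) : ℝ) = 0 := by
    rw [intervalIntegral.integral_of_le hpi.le] at hmean ⊢
    refine (MeasureTheory.integral_congr_ae ?_).trans hmean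
    filter_upwards [hF.ae] with x hx
    rw [hx.1]
  have h1 := ha.integral_sq_le hpi hmean'
    ((intervalIntegrable_iff_integrableOn_Ioc_of_le hpi.le).2 hdi)
  rw [intervalIntegral.integral_of_le hpi.le, intervalIntegral.integral_of_le hpi.le] at h1
  exact h1.trans (mul_le_mul_of_nonneg_left hdle (sq_nonneg _))

end IsACRepresentative

theorem proposition7 {d m : ℕ} (M : Set (EuclideanSpace ℝ (Fin d)))
    (hM : IsSmoothSubmanifold m M) (hMc : IsCompact M)
    (S : Fin d → Fin d → EuclideanSpace ℝ (Fin d) → EuclideanSpace ℝ (Fin d))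
    (hS : IsExtendedSecondFundamentalForm M S)
    (γ : ℝ → EuclideanSpace ℝ (Fin d)) (hγ : IsClosedGeodesic M γ)
    (hγ_nonconst : ∃ x, deriv γ x ≠ 0)
    (hK : NegativeSectionalCurvatureOn M γ) :
    ∃ c : ℝ, 0 < c ∧
      ∀ φ φ' : ℝ → EuclideanSpace ℝ (Fin d), IsH1TangentField M γ φ φ' →
        (∫ x in (0 : ℝ)..2 * Real.pi, inner ℝ (φ x) (deriv γ x)) = 0 →
          c * ((∫ x in (0 : ℝ)..2 * Real.pi, ‖φ x‖ ^ 2)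
              + ∫ x in (0 : ℝ)..2 * Real.pi, ‖φ' x‖ ^ 2)
            ≤ -jacobiPairing S γ φ φ' φ φ' := by
  have hpi : (0 : ℝ) < 2 * Real.pi := Real.two_pi_pos
  obtain ⟨x₀, hx₀⟩ := hγ_nonconst
  have hl0 : 0 < ‖deriv γ 0‖ ^ 2 := by
    rw [hγ.norm_deriv_sq_eq 0 x₀]
    exact pow_pos (norm_pos_iff.2 hx₀) 2
  have hv0 : ∀ x, deriv γ x ≠ 0 := fun x hx => by
    have := hγ.norm_deriv_sq_eq x 0
    rw [hx, norm_zero, zero_pow two_ne_zero] at this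
    exact hl0.ne this
  have hvc : Continuous (deriv γ) := hγ.contDiff_deriv.continuous
  have hγd : Differentiable ℝ γ := hγ.contDiff.differentiable (by norm_num)
  have hγc := hγd.continuous
  obtain ⟨κ, hκ0, hκ⟩ := exists_negCurvatureForm_ge hM hS hγc hγ.mem hK hvc hγ.deriv_mem hv0
    0 (2 * Real.pi)
  obtain ⟨B, hB0, hB⟩ := exists_norm_extForm_le hS hγc hvc 0 (2 * Real.pi)
  have hC : 0 < 1 + (1 + B) * ((2 * Real.pi) ^ 2 + κ⁻¹) := by positivity
  refine ⟨(1 + (1 + B) * ((2 * Real.pi) ^ 2 + κ⁻¹))⁻¹, inv_pos.2 hC, fun φ φ' h hmean => ?_⟩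
  obtain ⟨F, hF⟩ := h.exists_isACRepresentative hM hS hγd hγ.mem
  have hFc := hF.continuous
  have hDi := hF.integrable_tangentialPart hS hγ h
  have hpoinc := hF.integral_inner_sq_le hS hγ h hmean
  have hD0 := (MeasureTheory.integral_nonneg fun x => sq_nonneg _).trans hpoinc
  rw [hF.neg_jacobiPairing_eq hM hS hγ h]
  set μ := MeasureTheory.volume.restrict (Set.Ioc 0 (2 * Real.pi)) with hμ
  have hA : MeasureTheory.Integrable (fun x => ‖extForm S (γ x) (deriv γ x) (F x)‖ ^ 2) μ :=
    integrable_restrict_Ioc_of_continuous ((continuous_extForm hS hγc hvc hFc).norm.pow 2) _ _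
  have hNi : MeasureTheory.Integrable (fun x => negCurvatureForm S (γ x) (deriv γ x) (F x)) μ :=
    integrable_restrict_Ioc_of_continuous (continuous_negCurvatureForm hS hγc hvc hFc) _ _
  have hai : MeasureTheory.Integrable (fun x => (inner ℝ (F x) (deriv γ x) : ℝ) ^ 2) μ :=
    integrable_restrict_Ioc_of_continuous ((hFc.inner hvc).pow 2) _ _
  have hFi : MeasureTheory.Integrable (fun x => ‖F x‖ ^ 2) μ :=
    integrable_restrict_Ioc_of_continuous (hFc.norm.pow 2) _ _
  have hφ : ∫ x in (0 : ℝ)..2 * Real.pi, ‖φ x‖ ^ 2 = ∫ x, ‖F x‖ ^ 2 ∂μ := by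
    rw [intervalIntegral.integral_of_le hpi.le]
    exact MeasureTheory.integral_congr_ae (hF.ae.mono fun x hx => by simp only [hx.1])
  have hφ' : ∫ x in (0 : ℝ)..2 * Real.pi, ‖φ' x‖ ^ 2
      = (∫ x, (‖φ' x‖ ^ 2 - ‖extForm S (γ x) (deriv γ x) (F x)‖ ^ 2) ∂μ)
        + ∫ x, ‖extForm S (γ x) (deriv γ x) (F x)‖ ^ 2 ∂μ := by
    rw [intervalIntegral.integral_of_le hpi.le, ← MeasureTheory.integral_add hDi hA]
    simp only [sub_add_cancel, hμ]
  have hAle : ∫ x, ‖extForm S (γ x) (deriv γ x) (F x)‖ ^ 2 ∂μ ≤ B * ∫ x, ‖F x‖ ^ 2 ∂μ := by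
    rw [← MeasureTheory.integral_const_mul]
    refine MeasureTheory.integral_mono_ae hA (hFi.const_mul B) ?_
    filter_upwards [MeasureTheory.ae_restrict_mem measurableSet_Ioc] with x hx
    exact hB x (Set.Ioc_subset_Icc_self hx) (F x)
  have hsplit : ∀ᵐ x ∂μ, 0 ≤ negCurvatureForm S (γ x) (deriv γ x) (F x) ∧
      ‖F x‖ ^ 2 ≤ (‖deriv γ 0‖ ^ 2)⁻¹ * inner ℝ (F x) (deriv γ x) ^ 2
        + κ⁻¹ * negCurvatureForm S (γ x) (deriv γ x) (F x) := by
    filter_upwards [hF.ae, MeasureTheory.ae_restrict_mem measurableSet_Ioc] with x hx hxI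
    rw [hγ.norm_deriv_sq_eq 0 x]
    exact norm_sq_le_of_negCurvatureForm_ge hS (hγ.deriv_mem x) hx.2.1 (hv0 x) hκ0
      (hκ x (Set.Ioc_subset_Icc_self hxI))
  have hN0 : 0 ≤ ∫ x, negCurvatureForm S (γ x) (deriv γ x) (F x) ∂μ :=
    MeasureTheory.integral_nonneg_of_ae (hsplit.mono fun x hx => hx.1)
  have hFle := MeasureTheory.integral_mono_ae hFi
    ((hai.const_mul (‖deriv γ 0‖ ^ 2)⁻¹).add (hNi.const_mul κ⁻¹)) (hsplit.mono fun x hx => hx.2)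
  rw [MeasureTheory.integral_add' (hai.const_mul _) (hNi.const_mul _),
    MeasureTheory.integral_const_mul, MeasureTheory.integral_const_mul] at hFle
  rw [hφ, hφ', inv_mul_le_iff₀ hC]
  generalize (∫ x, (‖φ' x‖ ^ 2 - ‖extForm S (γ x) (deriv γ x) (F x)‖ ^ 2) ∂μ) = D at *
  generalize (∫ x, negCurvatureForm S (γ x) (deriv γ x) (F x) ∂μ) = N at *
  generalize (∫ x, ‖F x‖ ^ 2 ∂μ) = X at *
  have hD : 0 ≤ D :=
    nonneg_of_mul_nonneg_right (nonneg_of_mul_nonneg_right hD0 (by positivity)) hl0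
  have h1 : (‖deriv γ 0‖ ^ 2)⁻¹ * (∫ x, inner ℝ (F x) (deriv γ x) ^ 2 ∂μ)
      ≤ (2 * Real.pi) ^ 2 * D := by
    rw [inv_mul_le_iff₀ hl0]
    linarith
  have h2 : 0 ≤ (2 * Real.pi) ^ 2 * N := by positivity
  have h3 : 0 ≤ κ⁻¹ * D := by positivity
  have h4 : X ≤ ((2 * Real.pi) ^ 2 + κ⁻¹) * (D + N) := by linarith
  have h5 := mul_le_mul_of_nonneg_left h4 (by positivity : 0 ≤ 1 + B)
  linarith
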